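/- Notation. For an integer $m\ge 1$ let $\mathcal M_m$ be the set of integral $2\times2$ matrices of determinant $m$ modulo $\pm1$, $\mathcal M_m^+\subset\mathcal M_m$ the subset of classes having a representative with nonnegative entries, and $\mathcal R_m=\mathbb Z[\mathcal M_m]$, $\mathcal R_m^+=\mathbb Z[\mathcal M_m^+]$ the groups of finite formal $\mathbb Z$-linear combinations, multiplied by means of matrix multiplication. Put $S=\begin{pmatrix}0&-1\\1&0\end{pmatrix}$, $T=\begin{pmatrix}1&1\\0&1\end{pmatrix}$ and $T_m^\infty=\sum_{ad=m,\ 0\le b<d}\begin{pmatrix}a&b\\0&d\end{pmatrix}$. An element $\tilde T_m\in\mathcal R_m^+$ satisfies the compatibility criterion if $$T_m^\infty(T-1)\equiv 0,\qquad T_m^\infty(S-1)\equiv(S-1)\tilde T_m\pmod{(T-1)\mathcal R_m}.$$ For $w\in\mathbb C$ let $(F|_w g)(z)=|\det g|^{w/2}(cz+d)^{-w}F\!\left(\frac{az+b}{cz+d}\right)$, $g=\begin{pmatrix}a&b\\c&d\end{pmatrix}$, with principal powers ($-\pi<\arg\le\pi$), extended linearly to formal sums; for elements of $\mathcal M_m^+$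 acting on functions on $\mathbb C'=\mathbb C\smallsetminus(-\infty,0]$ the representative with nonnegative entries is used. For $s\in\mathbb C$ let $FE_s$ be the space of period-like functions: holomorphic $\psi:\mathbb C'\to\mathbb C$ with $\psi(z)=\psi(z+1)+(z+1)^{-2s}\psi\!\left(\frac z{z+1}\right)$. For $\sigma=\operatorname{Re}s>0$ let $FE_s^*\subset FE_s$ be the subspace of period functions, i.e. those with, for some $A>0$, $\psi(z)\ll|\operatorname{Im}z|^{-A}(1+|z|^{2A-2\sigma})$ if $\operatorname{Re}z\le0$, $\psi(z)\ll1$ if $\operatorname{Re}z\ge0$, $|z|\le1$, and $\psi(z)\ll|z|^{-2\sigma}$ if $\operatorname{Re}z\ge0$, $|z|\ge1$. Let $S(s)$ be the space of Maass cusp forms with spectral parameter $s$: real-analytic $\mathrm{PSL}_2(\mathbb Z)$-invariant functions $u$ on the upper half plane with $-y^2(\partial_x^2+\partial_y^2)u=s(1-s)u$ and $u(z)=O(y^C)$ as $y=\operatorname{Im}z\to\infty$ for every $C\in\mathbb R$. Fix a constant $c(s)\ne0$. We say that $\psi\in FE_s^*$ is the period function of $u\in S(s)$ if there are coefficients $a_n$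 and a function $f$ on $\mathbb C\smallsetminus\mathbb R$ such that $$u(x+iy)=\sqrt y\sum_{n\ne0}a_nK_{s-\frac12}(2\pi|n|y)e^{2\pi inx},$$ $$f(z)=\sum_{n>0}n^{s-\frac12}a_ne^{2\pi inz}\ (\operatorname{Im}z>0),\qquad f(z)=-\sum_{n<0}|n|^{s-\frac12}a_ne^{2\pi inz}\ (\operatorname{Im}z<0),$$ and $c(s)\psi(z)=f(z)-z^{-2s}f(-1/z)$ for $z\in\mathbb C\smallsetminus\mathbb R$, where $K_\nu$ is the $K$-Bessel function and the series converge absolutely. Corollary. Let $m\ge1$ be an integer and let $\tilde T_m\in\mathcal R_m^+$ satisfy the compatibility criterion. (i) For every $s\in\mathbb C$, $\psi\mapsto\psi|_{2s}\tilde T_m$ is a well-defined linear operator $FE_s\to FE_s$, and every other element of $\mathcal R_m^+$ satisfying the compatibility criterion gives the same operator. (ii) Let $\operatorname{Re}s>0$. If $\psi\in FE_s^*$ is the period function of $u\in S(s)$, then $u|_0T_m^\infty\in S(s)$, $\psi|_{2s}\tilde T_m\in FE_s^*$, and $\psi|_{2s}\tilde T_m$ is the period function of $u|_0T_m^\infty$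 (with the same constant $c(s)$). -/

import Mathlib

noncomputable section

namespace PeriodHecke

/-! ### Integral matrices modulo sign and their formal sums -/

/-- The congruence `A ∼ ± A` on integral `2 × 2` matrices. -/
def signCon : Con (Matrix (Fin 2) (Fin 2) ℤ) where
  r A B := A = B ∨ A = -B
  iseqv :=
    { refl := fun _ => Or.inl rfl
      symm := by
        rintro A B (h | h)
        · exact Or.inl h.symm
        · exact Or.inr (by rw [h, neg_neg])
      trans := by
        rintro A B C (h | h) (k | k)
        · exact Or.inl (h.trans k)
        · exact Or.inr (h.trans k)
        · exact Or.inr (by rw [h, k])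
        · exact Or.inl (by rw [h, k, neg_neg]) }
  mul' := by
    rintro A B C D (h | h) (k | k)
    · exact Or.inl (by rw [h, k])
    · exact Or.inr (by rw [h, k, mul_neg])
    · exact Or.inr (by rw [h, k, neg_mul])
    · exact Or.inl (by rw [h, k, neg_mul_neg])

/-- The multiplicative monoid of integral `2 × 2` matrices modulo `± 1`.
It contains every `M_m = Mat_m(ℤ) / {± 1}`, `m ≥ 1`. -/
abbrev MatPM : Type := signCon.Quotient

/-- The class of a matrix modulo sign. -/
def cls (A : Matrix (Fin 2) (Fin 2) ℤ) : MatPM := (A : signCon.Quotient)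

/-- `M_m`: the classes of the matrices of determinant `m`. -/
def matSet (m : ℕ) : Set MatPM := {g | ∃ A, A.det = (m : ℤ) ∧ cls A = g}

/-- `M_m⁺`: the classes in `M_m` with a representative with nonnegative entries. -/
def matSetPos (m : ℕ) : Set MatPM :=
  {g | ∃ A, A.det = (m : ℤ) ∧ (∀ i j, 0 ≤ A i j) ∧ cls A = g}

/-- Formal finite `ℤ`-linear combinations of classes of matrices, with the multiplication
that extends matrix multiplication. -/
abbrev Sums : Type := MonoidAlgebra ℤ MatPM

/-- `R_m = ℤ[M_m]`: the formal sums supported on `M_m`. -/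
def R (m : ℕ) : Set Sums := {X | ∀ g, X.coeff g ≠ 0 → g ∈ matSet m}

/-- `R_m⁺ = ℤ[M_m⁺]`: the formal sums supported on `M_m⁺`. -/
def RPos (m : ℕ) : Set Sums := {X | ∀ g, X.coeff g ≠ 0 → g ∈ matSetPos m}

/-- The matrix `(a, b; c, d)`, as a formal sum with one term. -/
def mat (a b c d : ℤ) : Sums := MonoidAlgebra.of ℤ MatPM (cls !![a, b; c, d])

def S : Sums := mat 0 (-1) 1 0

def T : Sums := mat 1 1 0 1

/-- `T_m^∞ = ∑ (a, b; 0, d)`, over `a d = m` and `0 ≤ b < d`. -/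
def heckeInf (m : ℕ) : Sums :=
  ∑ p ∈ m.divisorsAntidiagonal, ∑ b ∈ Finset.range p.2, mat (p.1 : ℤ) (b : ℤ) 0 (p.2 : ℤ)

/-- The compatibility criterion for a formal sum `X`: modulo `(T - 1) R_m`,
`T_m^∞ (T - 1) ≡ 0` and `T_m^∞ (S - 1) ≡ (S - 1) X`. -/
def IsCompatible (m : ℕ) (X : Sums) : Prop :=
  (∃ Y ∈ R m, heckeInf m * (T - 1) = (T - 1) * Y) ∧
  (∃ Y ∈ R m, heckeInf m * (S - 1) - (S - 1) * X = (T - 1) * Y)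

/-! ### The slash action -/

open Classical in
/-- A representative of a class: the one with nonnegative entries if there is one
(it is then unique, see `rep_cls`), and an arbitrary one otherwise. -/
def rep (g : MatPM) : Matrix (Fin 2) (Fin 2) ℤ :=
  if h : ∃ A, (∀ i j, 0 ≤ A i j) ∧ cls A = g then h.choose else Quotient.out g

theorem cls_eq_iff (A B : Matrix (Fin 2) (Fin 2) ℤ) : cls A = cls B ↔ A = B ∨ A = -B :=
  Con.eq signCon

theorem cls_rep (g : MatPM) : cls (rep g) = g := by
  unfold rep
  split_ifs with h
  · exact h.choose_spec.2
  · exact Quotient.out_eq g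

theorem rep_cls (A : Matrix (Fin 2) (Fin 2) ℤ) (hA : ∀ i j, 0 ≤ A i j) : rep (cls A) = A := by
  have h : ∃ B, (∀ i j, 0 ≤ B i j) ∧ cls B = cls A := ⟨A, hA, rfl⟩
  have e : rep (cls A) = h.choose := by
    unfold rep
    rw [dif_pos h]
  rw [e]
  obtain ⟨h1, h2⟩ := h.choose_spec
  rcases (cls_eq_iff _ _).1 h2 with h3 | h3
  · exact h3
  · ext i j
    have h4 := h1 i j
    have h5 : h.choose i j = -A i j := by
      conv_lhs => rw [h3]
      rfl
    have h6 := hA i j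
    lia

/-- `(F|_w A)(z) = |det A|^{w/2} (cz + d)^{-w} F((az + b)/(cz + d))` for `A = (a, b; c, d)`;
powers are principal values, with `-π < arg ≤ π`. -/
def slashMat (w : ℂ) (F : ℂ → ℂ) (A : Matrix (Fin 2) (Fin 2) ℤ) (z : ℂ) : ℂ :=
  ((|A.det| : ℤ) : ℂ) ^ (w / 2) * ((A 1 0 : ℂ) * z + (A 1 1 : ℂ)) ^ (-w) *
    F (((A 0 0 : ℂ) * z + (A 0 1 : ℂ)) / ((A 1 0 : ℂ) * z + (A 1 1 : ℂ)))

/-- The linear extension of the slash action to formal sums. It is used for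
`w = 0`, where the representative does not matter, and for formal sums in `R_m⁺`, where the
representative is the one with nonnegative entries. -/
def slash (w : ℂ) (F : ℂ → ℂ) (X : Sums) (z : ℂ) : ℂ :=
  X.coeff.sum fun g n => (n : ℂ) * slashMat w F (rep g) z

open Classical in
/-- The extension by zero to `ℂ` of a function on the cut plane `ℂ ∖ (-∞, 0]`. -/
def ext (ψ : Complex.slitPlane → ℂ) (z : ℂ) : ℂ :=
  if h : z ∈ Complex.slitPlane then ψ ⟨z, h⟩ else 0

/-- `ψ|_w X` for a function `ψ` on the cut plane and `X ∈ R_m⁺`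
(matrices in `M_m⁺` map the cut plane to itself, so the extension by zero plays no role). -/
def slashCut (w : ℂ) (ψ : Complex.slitPlane → ℂ) (X : Sums) : Complex.slitPlane → ℂ :=
  fun z => slash w (ext ψ) X z

/-- `u|_0 X` for a function `u` on the upper half plane. -/
def slashUpper (u : UpperHalfPlane → ℂ) (X : Sums) : UpperHalfPlane → ℂ :=
  fun z => slash 0 (fun w => u (UpperHalfPlane.ofComplex w)) X z

/-! ### Period-like functions and period functions -/

theorem ext_coe (ψ : Complex.slitPlane → ℂ) (z : Complex.slitPlane) : ext ψ z = ψ z := by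
  simp [ext]

theorem ext_add (ψ φ : Complex.slitPlane → ℂ) (z : ℂ) :
    ext (ψ + φ) z = ext ψ z + ext φ z := by
  unfold ext
  split_ifs <;> simp

theorem ext_smul (c : ℂ) (ψ : Complex.slitPlane → ℂ) (z : ℂ) :
    ext (c • ψ) z = c * ext ψ z := by
  unfold ext
  split_ifs <;> simp

/-- The space `FE_s` of period-like functions with parameter `s`: the holomorphic functions on
the cut plane that satisfy the three term equation
`ψ(z) = ψ(z + 1) + (z + 1)^{-2s} ψ(z / (z + 1))`. -/
def FE (s : ℂ) : Submodule ℂ (Complex.slitPlane → ℂ) where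
  carrier := {ψ | DifferentiableOn ℂ (ext ψ) Complex.slitPlane ∧
    ∀ z ∈ Complex.slitPlane,
      ext ψ z = ext ψ (z + 1) + (z + 1) ^ (-2 * s) * ext ψ (z / (z + 1))}
  zero_mem' := by
    have h : ext 0 = fun _ => (0 : ℂ) := by
      funext z
      unfold ext
      split_ifs <;> rfl
    refine ⟨?_, ?_⟩
    · rw [h]
      exact differentiableOn_const 0
    · intro z _
      simp [h]
  add_mem' := by
    rintro ψ φ ⟨h1, h2⟩ ⟨h3, h4⟩
    refine ⟨?_, ?_⟩
    · rw [show ext (ψ + φ) = fun z => ext ψ z + ext φ z from funext (ext_add ψ φ)]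
      exact h1.add h3
    · intro z hz
      rw [ext_add, ext_add, ext_add, h2 z hz, h4 z hz]
      ring
  smul_mem' := by
    rintro c ψ ⟨h1, h2⟩
    refine ⟨?_, ?_⟩
    · rw [show ext (c • ψ) = fun z => c * ext ψ z from funext (ext_smul c ψ)]
      exact h1.const_mul c
    · intro z hz
      rw [ext_smul, ext_smul, ext_smul, h2 z hz]
      ring

/-- `ψ ∈ FE_s^*`: `ψ` is a period function with parameter `s`, i.e. a period-like function
with the growth condition, for `σ = Re s` and some `A > 0`. -/
def IsPeriodFunction (s : ℂ) (ψ : Complex.slitPlane → ℂ) : Prop :=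
  ψ ∈ FE s ∧
  ∃ A : ℝ, 0 < A ∧ ∃ C : ℝ, ∀ z : Complex.slitPlane,
    ((z : ℂ).re ≤ 0 →
      ‖ψ z‖ ≤ C * (|(z : ℂ).im| ^ (-A) * (1 + ‖(z : ℂ)‖ ^ (2 * A - 2 * s.re)))) ∧
    (0 ≤ (z : ℂ).re → ‖(z : ℂ)‖ ≤ 1 → ‖ψ z‖ ≤ C) ∧
    (0 ≤ (z : ℂ).re → 1 ≤ ‖(z : ℂ)‖ → ‖ψ z‖ ≤ C * ‖(z : ℂ)‖ ^ (-2 * s.re))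

/-! ### Maass cusp forms -/

/-- `u ∈ S(s)`: `u` is a Maass cusp form for the full modular group with spectral parameter `s`,
i.e. a real-analytic, invariant function with `-y² (∂ₓ² + ∂_y²) u = s (1 - s) u`
and `u = O(y^C)` as `y → ∞` for all real `C`. -/
structure IsMaassCuspForm (s : ℂ) (u : UpperHalfPlane → ℂ) : Prop where
  analytic : AnalyticOnNhd ℝ (fun z : ℂ => u (UpperHalfPlane.ofComplex z)) {z | 0 < z.im}
  invariant : ∀ (g : Matrix.SpecialLinearGroup (Fin 2) ℤ) (z : UpperHalfPlane), u (g • z) = u z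
  eigen : ∀ z : UpperHalfPlane,
    -((z.im : ℂ) ^ 2) *
      (Laplacian.laplacian (fun w : ℂ => u (UpperHalfPlane.ofComplex w)) : ℂ → ℂ) z =
      s * (1 - s) * u z
  decay : ∀ C : ℝ, u =O[UpperHalfPlane.atImInfty] fun z => z.im ^ C

/-- The `K`-Bessel function `K_ν(t) = ∫₀^∞ exp(-t cosh x) cosh(ν x) dx`, for `t > 0`. -/
def besselK (ν : ℂ) (t : ℝ) : ℂ :=
  ∫ x in Set.Ioi (0 : ℝ), Complex.exp (-(t : ℂ) * Complex.cosh (x : ℂ)) * Complex.cosh (ν * x)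

/-- The Fourier expansion `u(x + iy) = √y ∑_{n ≠ 0} a_n K_{s-1/2}(2π|n|y) e^{2πinx}`. -/
def HasFourierExpansion (s : ℂ) (u : UpperHalfPlane → ℂ) (a : ℤ → ℂ) : Prop :=
  ∀ z : UpperHalfPlane,
    HasSum (fun n : {n : ℤ // n ≠ 0} =>
      (Real.sqrt z.im : ℂ) * (a n * besselK (s - 1 / 2) (2 * Real.pi * |((n : ℤ) : ℝ)| * z.im) *
        Complex.exp (2 * Real.pi * Complex.I * ((n : ℤ) : ℂ) * (z.re : ℂ)))) (u z)

/-- `f(z) = ∑_{n > 0} n^{s-1/2} a_n e^{2πinz}` for `Im z > 0` and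
`f(z) = -∑_{n < 0} |n|^{s-1/2} a_n e^{2πinz}` for `Im z < 0`. -/
def HasPeriodicExpansion (s : ℂ) (f : ℂ → ℂ) (a : ℤ → ℂ) : Prop :=
  (∀ z : ℂ, 0 < z.im →
    HasSum (fun n : ℕ+ => ((n : ℕ) : ℂ) ^ (s - 1 / 2) * a ((n : ℕ) : ℤ) *
      Complex.exp (2 * Real.pi * Complex.I * ((n : ℕ) : ℂ) * z)) (f z)) ∧
  (∀ z : ℂ, z.im < 0 →
    HasSum (fun n : ℕ+ => -(((n : ℕ) : ℂ) ^ (s - 1 / 2) * a (-((n : ℕ) : ℤ)) *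
      Complex.exp (2 * Real.pi * Complex.I * (-((n : ℕ) : ℂ)) * z))) (f z))

/-- `ψ ∈ FE_s^*` is the period function of the Maass cusp form `u ∈ S(s)`, for the value `c` of
the normalizing constant `c(s)`: with the Fourier coefficients of `u` and the periodic
function `f` of `u`, `c ψ(z) = f(z) - z^{-2s} f(-1/z)` on `ℂ ∖ ℝ`. -/
def IsPeriodFunctionOf (c s : ℂ) (u : UpperHalfPlane → ℂ) (ψ : Complex.slitPlane → ℂ) : Prop :=
  IsMaassCuspForm s u ∧ IsPeriodFunction s ψ ∧
  ∃ (a : ℤ → ℂ) (f : ℂ → ℂ), HasFourierExpansion s u a ∧ HasPeriodicExpansion s f a ∧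
    ∀ z : Complex.slitPlane, (z : ℂ).im ≠ 0 →
      c * ψ z = f z - (z : ℂ) ^ (-2 * s) * f (-1 / (z : ℂ))

end PeriodHecke

end

noncomputable section

namespace PeriodHecke

/-! ### Linear extension to formal sums -/

/-- The additive extension to formal sums of a function on the classes of matrices. -/
def lin {A : Type*} [Ring A] (φ : MatPM → A) : Sums →+ A where
  toFun X := X.coeff.sum fun g n => (n : A) * φ g
  map_zero' := by simp
  map_add' X Y := by
    rw [MonoidAlgebra.coeff_add, Finsupp.sum_add_index']
    · simp
    · intro g n k
      rw [Int.cast_add, add_mul]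

variable {A : Type*} [Ring A]

theorem lin_apply (φ : MatPM → A) (X : Sums) :
    lin φ X = X.coeff.sum fun g n => (n : A) * φ g := rfl

theorem lin_single (φ : MatPM → A) (g : MatPM) (n : ℤ) :
    lin φ (MonoidAlgebra.single g n) = (n : A) * φ g := by
  rw [lin_apply, MonoidAlgebra.coeff_single, Finsupp.sum_single_index]
  simp

theorem lin_of (φ : MatPM → A) (g : MatPM) :
    lin φ (MonoidAlgebra.of ℤ MatPM g) = φ g := by
  rw [MonoidAlgebra.of_apply, lin_single]
  simp

theorem lin_mat (φ : MatPM → A) (a b c d : ℤ) : lin φ (mat a b c d) = φ (cls !![a, b; c, d]) :=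
  lin_of φ _

theorem lin_of_mul (φ : MatPM → A) (h : MatPM) (X : Sums) :
    lin φ (MonoidAlgebra.of ℤ MatPM h * X) = lin (fun g => φ (h * g)) X := by
  induction X using MonoidAlgebra.induction_linear with
  | zero => simp
  | add X Y hX hY => rw [mul_add, map_add, map_add, hX, hY]
  | single g n =>
    rw [MonoidAlgebra.of_apply, MonoidAlgebra.single_mul_single, lin_single, lin_single, one_mul]

theorem lin_mul_of (φ : MatPM → A) (h : MatPM) (X : Sums) :
    lin φ (X * MonoidAlgebra.of ℤ MatPM h) = lin (fun g => φ (g * h)) X := by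
  induction X using MonoidAlgebra.induction_linear with
  | zero => simp
  | add X Y hX hY => rw [add_mul, map_add, map_add, hX, hY]
  | single g n =>
    rw [MonoidAlgebra.of_apply, MonoidAlgebra.single_mul_single, lin_single, lin_single, mul_one]

theorem lin_congr {φ φ' : MatPM → A} {X : Sums} (h : ∀ g, X.coeff g ≠ 0 → φ g = φ' g) :
    lin φ X = lin φ' X := by
  rw [lin_apply, lin_apply]
  exact Finsupp.sum_congr fun g hg => by rw [h g (Finsupp.mem_support_iff.1 hg)]

theorem lin_sub_fun (φ φ' : MatPM → A) (X : Sums) :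
    lin (fun g => φ g - φ' g) X = lin φ X - lin φ' X := by
  simp only [lin_apply, mul_sub, Finsupp.sum_sub]

theorem lin_add_fun (φ φ' : MatPM → A) (X : Sums) :
    lin (fun g => φ g + φ' g) X = lin φ X + lin φ' X := by
  simp only [lin_apply, mul_add, Finsupp.sum_add]

theorem lin_const_mul (c : ℂ) (φ : MatPM → ℂ) (X : Sums) :
    lin (fun g => c * φ g) X = c * lin φ X := by
  simp only [lin_apply, Finsupp.sum, Finset.mul_sum]
  exact Finset.sum_congr rfl fun g _ => by ring

/-! ### Matrices by their entries -/

theorem cls_mul_cls (a b c d e f g h : ℤ) :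
    cls !![a, b; c, d] * cls !![e, f; g, h] =
      cls !![a * e + b * g, a * f + b * h; c * e + d * g, c * f + d * h] := by
  change cls (!![a, b; c, d] * !![e, f; g, h]) = _
  rw [Matrix.mul_fin_two]

theorem mat_mul_mat (a b c d e f g h : ℤ) :
    mat a b c d * mat e f g h =
      mat (a * e + b * g) (a * f + b * h) (c * e + d * g) (c * f + d * h) := by
  rw [mat, mat, mat, ← map_mul, cls_mul_cls]

theorem mem_matSetPos_iff {m : ℕ} {g : MatPM} :
    g ∈ matSetPos m ↔ ∃ a b c d : ℤ, (0 ≤ a ∧ 0 ≤ b ∧ 0 ≤ c ∧ 0 ≤ d) ∧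
      a * d - b * c = m ∧ g = cls !![a, b; c, d] := by
  constructor
  · rintro ⟨A, hA, h0, rfl⟩
    refine ⟨A 0 0, A 0 1, A 1 0, A 1 1, ⟨h0 _ _, h0 _ _, h0 _ _, h0 _ _⟩, ?_, ?_⟩
    · rw [← hA, Matrix.det_fin_two]
    · rw [← Matrix.eta_fin_two]
  · rintro ⟨a, b, c, d, ⟨ha, hb, hc, hd⟩, h, rfl⟩
    refine ⟨_, by rw [Matrix.det_fin_two_of, h], ?_, rfl⟩
    intro i j
    fin_cases i <;> fin_cases j <;> simpa

theorem matSetPos_subset (m : ℕ) : matSetPos m ⊆ matSet m := by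
  rintro g ⟨A, hA, -, rfl⟩
  exact ⟨A, hA, rfl⟩

theorem cls_eq_cls_iff (a b c d e f g h : ℤ) :
    cls !![a, b; c, d] = cls !![e, f; g, h] ↔
      (a = e ∧ b = f ∧ c = g ∧ d = h) ∨ (a = -e ∧ b = -f ∧ c = -g ∧ d = -h) := by
  rw [cls_eq_iff]
  simp [and_assoc]

theorem rep_cls_of_nonneg {a b c d : ℤ} (ha : 0 ≤ a) (hb : 0 ≤ b) (hc : 0 ≤ c) (hd : 0 ≤ d) :
    rep (cls !![a, b; c, d]) = !![a, b; c, d] := by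
  apply rep_cls
  intro i j
  fin_cases i <;> fin_cases j <;> simpa

/-! ### Formal sums with nonnegative entries -/

theorem RPos_zero (m : ℕ) : (0 : Sums) ∈ RPos m := by
  intro g hg
  simp at hg

theorem RPos_add {m : ℕ} {X Y : Sums} (hX : X ∈ RPos m) (hY : Y ∈ RPos m) : X + Y ∈ RPos m := by
  intro g hg
  by_cases h : X.coeff g = 0
  · exact hY g fun h' => hg (by simp [h, h'])
  · exact hX g h

theorem RPos_neg {m : ℕ} {X : Sums} (hX : X ∈ RPos m) : -X ∈ RPos m := by
  intro g hg
  exact hX g fun h => hg (by simp [h])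

theorem RPos_sub {m : ℕ} {X Y : Sums} (hX : X ∈ RPos m) (hY : Y ∈ RPos m) : X - Y ∈ RPos m := by
  rw [sub_eq_add_neg]
  exact RPos_add hX (RPos_neg hY)

theorem RPos_single {m : ℕ} {g : MatPM} (hg : g ∈ matSetPos m) (n : ℤ) :
    MonoidAlgebra.single g n ∈ RPos m := by
  intro h hh
  by_cases e : h = g
  · exact e ▸ hg
  · exact absurd (Finsupp.single_eq_of_ne e) hh

theorem RPos_mul_mat {m : ℕ} {X : Sums} (hX : X ∈ RPos m) {a b c d : ℤ}
    (h0 : 0 ≤ a ∧ 0 ≤ b ∧ 0 ≤ c ∧ 0 ≤ d) (h1 : a * d - b * c = 1) : X * mat a b c d ∈ RPos m := by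
  rw [← MonoidAlgebra.ofCoeff_coeff X, ← Finsupp.sum_single X.coeff]
  rw [MonoidAlgebra.ofCoeff_finsuppSum, Finsupp.sum, Finset.sum_mul]
  refine Finset.sum_induction _ (· ∈ RPos m) (fun _ _ => RPos_add) (RPos_zero m) ?_
  intro g hg
  rw [MonoidAlgebra.ofCoeff_single, mat, MonoidAlgebra.of_apply, MonoidAlgebra.single_mul_single]
  apply RPos_single
  obtain ⟨e, f, k, l, ⟨he, hf, hk, hl⟩, h, rfl⟩ :=
    mem_matSetPos_iff.1 (hX g (Finsupp.mem_support_iff.1 hg))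
  obtain ⟨ha, hb, hc, hd⟩ := h0
  rw [cls_mul_cls]
  refine mem_matSetPos_iff.2 ⟨_, _, _, _, ⟨?_, ?_, ?_, ?_⟩, ?_, rfl⟩
  any_goals positivity
  linear_combination (e * l - f * k) * h1 + h

/-- The transpose of `T`. -/
def T' : Sums := mat 1 0 1 1

/-! ### The structure of positive cycles -/

/-- The rows `(x, y)` of a matrix in the order by `x + y`, then by `x`. -/
def RowLE (x y v w : ℤ) : Prop := x + y < v + w ∨ (x + y = v + w ∧ x ≤ v)

/-- The indicator function of the orbit of `(t, t'; v, v')` under left translations. -/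
def orbitInd (t t' v v' : ℤ) (g : MatPM) : ℤ :=
  open Classical in if ∃ k : ℤ, g = cls !![t + k * v, t' + k * v'; v, v'] then 1 else 0

theorem orbitInd_T_mul (t t' v v' : ℤ) (g : MatPM) :
    orbitInd t t' v v' (cls !![1, 1; 0, 1] * g) = orbitInd t t' v v' g := by
  have h : (∃ k : ℤ, cls !![1, 1; 0, 1] * g = cls !![t + k * v, t' + k * v'; v, v']) ↔
      ∃ k : ℤ, g = cls !![t + k * v, t' + k * v'; v, v'] := by
    constructor
    · rintro ⟨k, hk⟩
      refine ⟨k - 1, ?_⟩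
      have h1 : cls !![1, -1; 0, 1] * (cls !![1, 1; 0, 1] * g) = g := by
        rw [← mul_assoc, cls_mul_cls]
        norm_num
        rw [← Matrix.one_fin_two]
        exact one_mul g
      rw [← h1, hk, cls_mul_cls]
      ring_nf
    · rintro ⟨k, rfl⟩
      refine ⟨k + 1, ?_⟩
      rw [cls_mul_cls]
      ring_nf
  open Classical in exact if_congr h rfl rfl

theorem sum_orbitInd_eq {Z Y : Sums} (h : (S - 1) * Z = (T - 1) * Y) (t t' v v' : ℤ) :
    lin (fun g => orbitInd t t' v v' (cls !![0, -1; 1, 0] * g)) Z =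
      lin (orbitInd t t' v v') Z := by
  have h1 := congrArg (lin (orbitInd t t' v v')) h
  rw [sub_mul, sub_mul, map_sub, map_sub, S, T, mat, mat, lin_of_mul, lin_of_mul, one_mul,
    one_mul, funext (orbitInd_T_mul t t' v v'), sub_self] at h1
  exact sub_eq_zero.1 h1

theorem row_eq_of_sub {t t' p p' v v' k : ℤ} (ht : 0 < t + t') (hp : 0 < p + p')
    (htv : RowLE t t' v v') (hpv : RowLE p p' v v')
    (h : p = t + k * v) (h' : p' = t' + k * v') : k = 0 := by
  have htv' : t + t' ≤ v + v' := by
    rcases htv with h | h <;> lia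
  have hpv' : p + p' ≤ v + v' := by
    rcases hpv with h | h <;> lia
  have h1 : p + p' = t + t' + k * (v + v') := by rw [h, h']; ring
  rcases lt_trichotomy k 0 with hk | hk | hk
  · nlinarith
  · exact hk
  · nlinarith

theorem row_eq_of_add {t t' p p' v v' k : ℤ} (ht : 0 < t + t') (hp : 0 < p + p')
    (htv : RowLE t t' v v') (hpv : RowLE p p' v v')
    (hd : t * v' - t' * v ≠ 0)
    (h : p = k * v - t) (h' : p' = k * v' - t') : k = 1 := by
  have htv' : t + t' ≤ v + v' := by
    rcases htv with h | h <;> lia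
  have hpv' : p + p' ≤ v + v' := by
    rcases hpv with h | h <;> lia
  have h1 : p + p' = k * (v + v') - (t + t') := by rw [h, h']; ring
  have hk0 : 0 < k := by
    by_contra hk
    nlinarith
  have hk2 : k ≤ 2 := by
    by_contra hk
    nlinarith
  have hk : k = 1 ∨ k = 2 := by lia
  rcases hk with hk | rfl
  · exact hk
  · exfalso
    have e1 : t = v := by
      rcases htv with h2 | h2 <;> rcases hpv with h3 | h3 <;> lia
    have e2 : t' = v' := by
      rcases htv with h2 | h2 <;> rcases hpv with h3 | h3 <;> lia
    exact hd (by rw [e1, e2]; ring)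

theorem lin_eq_coeff {Z : Sums} {φ : MatPM → ℤ} {g₀ : MatPM}
    (h0 : φ g₀ = 1) (h : ∀ g, Z.coeff g ≠ 0 → φ g ≠ 0 → g = g₀) : lin φ Z = Z.coeff g₀ := by
  rw [lin_apply, Finsupp.sum, Finset.sum_eq_single g₀]
  · simp [h0]
  · intro g hg hne
    by_cases h1 : φ g = 0
    · simp [h1]
    · exact absurd (h g (Finsupp.mem_support_iff.1 hg) h1) hne
  · intro hg
    simp [Finsupp.notMem_support_iff.1 hg]

theorem exists_of_lin_ne_zero {Z : Sums} {φ : MatPM → ℤ} (h : lin φ Z ≠ 0) :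
    ∃ g, Z.coeff g ≠ 0 ∧ φ g ≠ 0 := by
  rw [lin_apply, Finsupp.sum] at h
  obtain ⟨g, hg, h1⟩ := Finset.exists_ne_zero_of_sum_ne_zero h
  exact ⟨g, Finsupp.mem_support_iff.1 hg, fun h2 => h1 (by simp [h2])⟩

theorem orbitInd_ne_zero {t t' v v' : ℤ} {g : MatPM} (h : orbitInd t t' v v' g ≠ 0) :
    ∃ k : ℤ, g = cls !![t + k * v, t' + k * v'; v, v'] := by
  unfold orbitInd at h
  by_contra h1
  exact h (if_neg h1)

theorem orbitInd_eq_one {t t' v v' : ℤ} {g : MatPM} (k : ℤ)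
    (h : g = cls !![t + k * v, t' + k * v'; v, v']) : orbitInd t t' v v' g = 1 :=
  if_pos ⟨k, h⟩

/-- Positive classes with bottom row `(v, v')` and lying over the same translation orbit. -/
theorem orbitInd_pos {m : ℕ} (hm : 1 ≤ m) {t t' v v' a b c d : ℤ} (hv : 0 ≤ v) (hv' : 0 ≤ v')
    (h0 : 0 ≤ a ∧ 0 ≤ b ∧ 0 ≤ c ∧ 0 ≤ d) (hdet : a * d - b * c = m)
    (h : orbitInd t t' v v' (cls !![a, b; c, d]) ≠ 0) :
    c = v ∧ d = v' ∧ ∃ k : ℤ, a = t + k * v ∧ b = t' + k * v' := by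
  obtain ⟨k, hk⟩ := orbitInd_ne_zero h
  rcases (cls_eq_cls_iff _ _ _ _ _ _ _ _).1 hk with ⟨h1, h2, h3, h4⟩ | ⟨h1, h2, h3, h4⟩
  · exact ⟨h3, h4, k, h1, h2⟩
  · exfalso
    have hc : c = 0 := by lia
    have hd : d = 0 := by lia
    rw [hc, hd] at hdet
    simp at hdet
    lia

/-- Positive classes with top row `(v, v')` and lying over the same translation orbit. -/
theorem orbitInd_S_pos {m : ℕ} (hm : 1 ≤ m) {t t' v v' a b c d : ℤ} (hv : 0 ≤ v) (hv' : 0 ≤ v')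
    (h0 : 0 ≤ a ∧ 0 ≤ b ∧ 0 ≤ c ∧ 0 ≤ d) (hdet : a * d - b * c = m)
    (h : orbitInd t t' v v' (cls !![0, -1; 1, 0] * cls !![a, b; c, d]) ≠ 0) :
    a = v ∧ b = v' ∧ ∃ k : ℤ, c = k * v - t ∧ d = k * v' - t' := by
  obtain ⟨k, hk⟩ := orbitInd_ne_zero h
  rw [cls_mul_cls] at hk
  rcases (cls_eq_cls_iff _ _ _ _ _ _ _ _).1 hk with ⟨h1, h2, h3, h4⟩ | ⟨h1, h2, h3, h4⟩
  · exact ⟨by lia, by lia, -k, by lia, by lia⟩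
  · exfalso
    have hc : a = 0 := by lia
    have hd : b = 0 := by lia
    rw [hc, hd] at hdet
    simp at hdet
    lia

theorem row_pos {m : ℕ} (hm : 1 ≤ m) {a b c d : ℤ}
    (h0 : 0 ≤ a ∧ 0 ≤ b ∧ 0 ≤ c ∧ 0 ≤ d) (hdet : a * d - b * c = m) :
    0 < a + b ∧ 0 < c + d := by
  obtain ⟨ha, hb, hc, hd⟩ := h0
  constructor
  · by_contra h
    have h1 : a = 0 := by lia
    have h2 : b = 0 := by lia
    subst h1 h2
    simp at hdet
    lia
  · by_contra h
    have h1 : c = 0 := by lia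
    have h2 : d = 0 := by lia
    subst h1 h2
    simp at hdet
    lia

theorem exists_maximal_row {m : ℕ} {Z : Sums} (hZ : Z ∈ RPos m) (hne : Z ≠ 0) :
    ∃ v v' : ℤ,
      ((∃ p p' : ℤ, (0 ≤ p ∧ 0 ≤ p' ∧ 0 ≤ v ∧ 0 ≤ v') ∧ p * v' - p' * v = m ∧
          Z.coeff (cls !![p, p'; v, v']) ≠ 0) ∨
        ∃ q q' : ℤ, (0 ≤ v ∧ 0 ≤ v' ∧ 0 ≤ q ∧ 0 ≤ q') ∧ v * q' - v' * q = m ∧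
          Z.coeff (cls !![v, v'; q, q']) ≠ 0) ∧
      ∀ a b c d : ℤ, (0 ≤ a ∧ 0 ≤ b ∧ 0 ≤ c ∧ 0 ≤ d) → Z.coeff (cls !![a, b; c, d]) ≠ 0 →
        RowLE a b v v' ∧ RowLE c d v v' := by
  have hs : (Z.coeff.support ×ˢ (Finset.univ : Finset (Fin 2))).Nonempty := by
    refine Finset.Nonempty.product ?_ Finset.univ_nonempty
    rw [Finset.nonempty_iff_ne_empty, Ne, Finsupp.support_eq_empty]
    simpa using hne
  obtain ⟨⟨g, i⟩, hgi, hmax⟩ := Finset.exists_max_image _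
    (fun x : MatPM × Fin 2 => toLex (rep x.1 x.2 0 + rep x.1 x.2 1, rep x.1 x.2 0)) hs
  have hg : Z.coeff g ≠ 0 := by simpa using hgi
  have hmax' : ∀ a b c d : ℤ, (0 ≤ a ∧ 0 ≤ b ∧ 0 ≤ c ∧ 0 ≤ d) →
      Z.coeff (cls !![a, b; c, d]) ≠ 0 →
      RowLE a b (rep g i 0) (rep g i 1) ∧ RowLE c d (rep g i 0) (rep g i 1) := by
    rintro a b c d ⟨ha, hb, hc, hd⟩ hne
    have h (j : Fin 2) := hmax (cls !![a, b; c, d], j) (by simpa using hne)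
    simp only [rep_cls_of_nonneg ha hb hc hd, Prod.Lex.le_iff, ofLex_toLex] at h
    exact ⟨by simpa [RowLE] using h 0, by simpa [RowLE] using h 1⟩
  refine ⟨rep g i 0, rep g i 1, ?_, hmax'⟩
  obtain ⟨a, b, c, d, h0, hdet, rfl⟩ := mem_matSetPos_iff.1 (hZ g hg)
  rw [rep_cls_of_nonneg h0.1 h0.2.1 h0.2.2.1 h0.2.2.2]
  fin_cases i
  · exact Or.inr ⟨c, d, h0, hdet, hg⟩
  · exact Or.inl ⟨a, b, h0, hdet, hg⟩

/-- Two positive classes in the support of a cycle that share their maximal row come from a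
common parent. -/
theorem exists_parent {m : ℕ} (hm : 1 ≤ m) {Z Y : Sums} (hZ : Z ∈ RPos m) (hne : Z ≠ 0)
    (h : (S - 1) * Z = (T - 1) * Y) :
    ∃ h ∈ matSetPos m, Z.coeff (cls !![1, 1; 0, 1] * h) ≠ 0 ∧
      Z.coeff (cls !![1, 1; 0, 1] * h) = Z.coeff (cls !![1, 0; 1, 1] * h) ∧
      cls !![1, 1; 0, 1] * h ≠ cls !![1, 0; 1, 1] * h ∧
      cls !![1, 1; 0, 1] * h ≠ h ∧ cls !![1, 0; 1, 1] * h ≠ h := by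
  obtain ⟨v, v', hex, hmax⟩ := exists_maximal_row hZ hne
  have main : ∀ p p' q q' : ℤ, (0 ≤ p ∧ 0 ≤ p' ∧ 0 ≤ q ∧ 0 ≤ q') → p * q' - p' * q = m →
      v = p + q → v' = p' + q' →
      (Z.coeff (cls !![p, p'; v, v']) ≠ 0 ∨ Z.coeff (cls !![v, v'; q, q']) ≠ 0) →
      RowLE p p' v v' → RowLE q q' v v' →
      ∃ h ∈ matSetPos m, Z.coeff (cls !![1, 1; 0, 1] * h) ≠ 0 ∧
        Z.coeff (cls !![1, 1; 0, 1] * h) = Z.coeff (cls !![1, 0; 1, 1] * h) ∧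
        cls !![1, 1; 0, 1] * h ≠ cls !![1, 0; 1, 1] * h ∧
        cls !![1, 1; 0, 1] * h ≠ h ∧ cls !![1, 0; 1, 1] * h ≠ h := by
    intro p p' q q' h0 hdet hv hv' hc hp hq
    obtain ⟨hp0, hq0⟩ := row_pos hm h0 hdet
    have hT : cls !![1, 1; 0, 1] * cls !![p, p'; q, q'] = cls !![v, v'; q, q'] := by
      rw [cls_mul_cls, hv, hv']
      ring_nf
    have hT' : cls !![1, 0; 1, 1] * cls !![p, p'; q, q'] = cls !![p, p'; v, v'] := by
      rw [cls_mul_cls, hv, hv']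
      ring_nf
    have e := sum_orbitInd_eq h p p' v v'
    rw [lin_eq_coeff (g₀ := cls !![v, v'; q, q']), lin_eq_coeff (g₀ := cls !![p, p'; v, v'])] at e
    · refine ⟨cls !![p, p'; q, q'], mem_matSetPos_iff.2 ⟨_, _, _, _, h0, hdet, rfl⟩, ?_⟩
      rw [hT, hT', e]
      refine ⟨?_, rfl, ?_, ?_, ?_⟩
      · rcases hc with hc | hc
        · exact hc
        · rwa [← e]
      all_goals
        rw [Ne, cls_eq_cls_iff]
        lia
    · exact orbitInd_eq_one 0 (by simp)
    · intro g hg hφ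
      obtain ⟨a, b, c, d, k0, kdet, rfl⟩ := mem_matSetPos_iff.1 (hZ g hg)
      obtain ⟨rfl, rfl, k, ha, hb⟩ := orbitInd_pos hm (by lia) (by lia) k0 kdet hφ
      have hk := row_eq_of_sub hp0 (row_pos hm k0 kdet).1 hp (hmax _ _ _ _ k0 hg).1 ha hb
      subst hk
      simp [ha, hb]
    · refine orbitInd_eq_one (-1) ?_
      rw [cls_mul_cls, cls_eq_cls_iff]
      left
      lia
    · intro g hg hφ
      obtain ⟨a, b, c, d, k0, kdet, rfl⟩ := mem_matSetPos_iff.1 (hZ g hg)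
      obtain ⟨rfl, rfl, k, ha, hb⟩ := orbitInd_S_pos hm (by lia) (by lia) k0 kdet hφ
      have hd0 : p * b - p' * a ≠ 0 := by
        rw [hv, hv']
        intro h
        have : p * q' - p' * q = 0 := by linear_combination h
        lia
      have hk := row_eq_of_add hp0 (row_pos hm k0 kdet).2 hp (hmax _ _ _ _ k0 hg).2 hd0 ha hb
      subst hk
      rw [ha, hb, hv, hv']
      ring_nf
  rcases hex with ⟨p, p', h0, hdet, hc⟩ | ⟨q, q', h0, hdet, hc⟩
  · have hp := (hmax _ _ _ _ h0 hc).1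
    have e := sum_orbitInd_eq h p p' v v'
    have e1 : lin (orbitInd p p' v v') Z = Z.coeff (cls !![p, p'; v, v']) := by
      apply lin_eq_coeff
      · exact orbitInd_eq_one 0 (by simp)
      · intro g hg hφ
        obtain ⟨a, b, c, d, k0, kdet, rfl⟩ := mem_matSetPos_iff.1 (hZ g hg)
        obtain ⟨rfl, rfl, k, ha, hb⟩ := orbitInd_pos hm (by lia) (by lia) k0 kdet hφ
        have hk := row_eq_of_sub (row_pos hm h0 hdet).1 (row_pos hm k0 kdet).1 hp
          (hmax _ _ _ _ k0 hg).1 ha hb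
        subst hk
        simp [ha, hb]
    obtain ⟨g, hg, hφ⟩ := exists_of_lin_ne_zero (e ▸ e1 ▸ hc)
    obtain ⟨a, b, c, d, k0, kdet, rfl⟩ := mem_matSetPos_iff.1 (hZ g hg)
    obtain ⟨rfl, rfl, k, ha, hb⟩ := orbitInd_S_pos hm (by lia) (by lia) k0 kdet hφ
    have hk := row_eq_of_add (row_pos hm h0 hdet).1 (row_pos hm k0 kdet).2 hp
      (hmax _ _ _ _ k0 hg).2 (by lia) ha hb
    subst hk
    refine main p p' c d ⟨h0.1, h0.2.1, k0.2.2⟩ ?_ (by lia) (by lia) (Or.inl hc) hp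
      (hmax _ _ _ _ k0 hg).2
    rw [ha, hb]
    linear_combination hdet
  · have hq := (hmax _ _ _ _ h0 hc).2
    have e := sum_orbitInd_eq h (-q) (-q') v v'
    have e1 : lin (fun g => orbitInd (-q) (-q') v v' (cls !![0, -1; 1, 0] * g)) Z =
        Z.coeff (cls !![v, v'; q, q']) := by
      apply lin_eq_coeff
      · refine orbitInd_eq_one 0 ?_
        rw [cls_mul_cls, cls_eq_cls_iff]
        left
        lia
      · intro g hg hφ
        obtain ⟨a, b, c, d, k0, kdet, rfl⟩ := mem_matSetPos_iff.1 (hZ g hg)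
        obtain ⟨rfl, rfl, k, ha, hb⟩ := orbitInd_S_pos hm (by lia) (by lia) k0 kdet hφ
        have hk := row_eq_of_sub (row_pos hm h0 hdet).2 (row_pos hm k0 kdet).2 hq
          (hmax _ _ _ _ k0 hg).2 (k := k) (by lia) (by lia)
        subst hk
        simp [ha, hb]
    obtain ⟨g, hg, hφ⟩ := exists_of_lin_ne_zero (e ▸ e1 ▸ hc)
    obtain ⟨a, b, c, d, k0, kdet, rfl⟩ := mem_matSetPos_iff.1 (hZ g hg)
    obtain ⟨rfl, rfl, k, ha, hb⟩ := orbitInd_pos hm (by lia) (by lia) k0 kdet hφ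
    have hk := row_eq_of_add (row_pos hm h0 hdet).2 (row_pos hm k0 kdet).1 hq
      (hmax _ _ _ _ k0 hg).1 (k := k) (by lia) (by lia) (by lia)
    subst hk
    refine main a b q q' ⟨k0.1, k0.2.1, h0.2.2⟩ ?_ (by lia) (by lia) (Or.inr hc)
      (hmax _ _ _ _ k0 hg).1 hq
    rw [ha, hb]
    linear_combination hdet

theorem three_term_mul_single (h : MatPM) (n : ℤ) :
    (1 - T - T') * MonoidAlgebra.single h n = MonoidAlgebra.single h n -
      MonoidAlgebra.single (cls !![1, 1; 0, 1] * h) n -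
      MonoidAlgebra.single (cls !![1, 0; 1, 1] * h) n := by
  rw [sub_mul, sub_mul, one_mul, T, T', mat, mat, MonoidAlgebra.of_apply, MonoidAlgebra.of_apply,
    MonoidAlgebra.single_mul_single, MonoidAlgebra.single_mul_single, one_mul]

theorem cycle_three_term : (S - 1) * (1 - T - T') = (T - 1) * (1 + S * T + mat 1 (-1) 0 1 * S) := by
  have h1 : S * T' = mat 1 (-1) 0 1 * S := by
    rw [S, T', mat_mul_mat, mat_mul_mat]
    norm_num
  have h2 : T * (S * T) = T' := by
    rw [S, T, T', mat_mul_mat, mat_mul_mat]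
    norm_num
  have h3 : T * (mat 1 (-1) 0 1 * S) = S := by
    rw [S, T, mat_mul_mat, mat_mul_mat]
    norm_num
  have h4 : (S - 1) * (1 - T - T') = S - S * T - S * T' - 1 + T + T' := by noncomm_ring
  have h5 : (T - 1) * (1 + S * T + mat 1 (-1) 0 1 * S) = T + T * (S * T) +
      T * (mat 1 (-1) 0 1 * S) - 1 - S * T - mat 1 (-1) 0 1 * S := by noncomm_ring
  rw [h4, h5, h1, h2, h3]
  abel

theorem exists_eq_three_term_mul {m : ℕ} (hm : 1 ≤ m) {Z : Sums} (hZ : Z ∈ RPos m)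
    (h : ∃ Y, (S - 1) * Z = (T - 1) * Y) : ∃ W ∈ RPos m, Z = (1 - T - T') * W := by
  classical
  induction hn : Z.coeff.support.card using Nat.strong_induction_on generalizing Z with
  | _ n ih =>
    by_cases hne : Z = 0
    · exact ⟨0, RPos_zero m, by simp [hne]⟩
    obtain ⟨Y, hY⟩ := h
    obtain ⟨h, hh, hc, hcc, h12, h1, h2⟩ := exists_parent hm hZ hne hY
    set N := Z.coeff (cls !![1, 1; 0, 1] * h) with hN
    have hW0 : MonoidAlgebra.single h N ∈ RPos m := RPos_single hh N
    have hTh : cls !![1, 1; 0, 1] * h ∈ matSetPos m := hZ _ hc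
    have hTh' : cls !![1, 0; 1, 1] * h ∈ matSetPos m := hZ _ (hcc ▸ hc)
    set Z' := Z + (1 - T - T') * MonoidAlgebra.single h N with hZ'
    have hZ'pos : Z' ∈ RPos m := by
      rw [hZ', three_term_mul_single]
      exact RPos_add hZ (RPos_sub (RPos_sub hW0 (RPos_single hTh N)) (RPos_single hTh' N))
    have hcard : Z'.coeff.support.card < n := by
      have hsub : Z'.coeff.support ⊆
          insert h ((Z.coeff.support.erase (cls !![1, 1; 0, 1] * h)).erase
            (cls !![1, 0; 1, 1] * h)) := by
        intro g hg
        rw [Finsupp.mem_support_iff, hZ', three_term_mul_single] at hg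
        simp only [MonoidAlgebra.coeff_add, MonoidAlgebra.coeff_sub, MonoidAlgebra.coeff_single,
          Finsupp.add_apply, Finsupp.sub_apply] at hg
        by_cases g0 : g = h
        · simp [g0]
        by_cases g1 : g = cls !![1, 1; 0, 1] * h
        · exfalso
          apply hg
          rw [Finsupp.single_eq_of_ne g0, g1, Finsupp.single_eq_same, Finsupp.single_eq_of_ne h12,
            ← hN]
          ring
        by_cases g2 : g = cls !![1, 0; 1, 1] * h
        · exfalso
          apply hg
          rw [Finsupp.single_eq_of_ne g0, Finsupp.single_eq_of_ne g1, g2, Finsupp.single_eq_same,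
            hcc]
          ring
        rw [Finsupp.single_eq_of_ne g0, Finsupp.single_eq_of_ne g1,
          Finsupp.single_eq_of_ne g2] at hg
        simp only [Finset.mem_insert, Finset.mem_erase, Finsupp.mem_support_iff]
        exact Or.inr ⟨g2, g1, by simpa using hg⟩
      have hm1 : cls !![1, 1; 0, 1] * h ∈ Z.coeff.support := Finsupp.mem_support_iff.2 hc
      have hm2 : cls !![1, 0; 1, 1] * h ∈ Z.coeff.support.erase (cls !![1, 1; 0, 1] * h) :=
        Finset.mem_erase.2 ⟨h12.symm, Finsupp.mem_support_iff.2 (hcc ▸ hc)⟩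
      have h3 := Finset.card_le_card hsub
      have h4 := Finset.card_insert_le h ((Z.coeff.support.erase (cls !![1, 1; 0, 1] * h)).erase
            (cls !![1, 0; 1, 1] * h))
      have h5 := Finset.card_erase_add_one hm1
      have h6 := Finset.card_erase_add_one hm2
      lia
    obtain ⟨W, hW, hWe⟩ := ih _ hcard hZ'pos
      ⟨Y + (1 + S * T + mat 1 (-1) 0 1 * S) * MonoidAlgebra.single h N, by
        rw [hZ', mul_add, mul_add, hY, ← mul_assoc, cycle_three_term, mul_assoc]⟩ rfl
    refine ⟨W - MonoidAlgebra.single h N, RPos_sub hW hW0, ?_⟩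
    rw [mul_sub, ← hWe, hZ']
    abel

theorem exists_mul_three_term {m : ℕ} (hm : 1 ≤ m) {X : Sums} (hX : X ∈ RPos m)
    (h : IsCompatible m X) : ∃ W ∈ RPos m, X * (1 - T - T') = (1 - T - T') * W := by
  obtain ⟨⟨Y₁, -, h1⟩, Y₂, -, h2⟩ := h
  refine exists_eq_three_term_mul hm ?_
    ⟨Y₁ * (1 + S * T + mat 1 (-1) 0 1 * S) - Y₂ * (1 - T - T'), ?_⟩
  · rw [mul_sub, mul_sub, mul_one]
    exact RPos_sub (RPos_sub hX (RPos_mul_mat hX (by norm_num) (by norm_num)))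
      (RPos_mul_mat hX (by norm_num) (by norm_num))
  · have h3 : (S - 1) * X = heckeInf m * (S - 1) - (T - 1) * Y₂ := by rw [← h2]; abel
    rw [← mul_assoc, h3, sub_mul, mul_assoc (heckeInf m), cycle_three_term, ← mul_assoc, h1,
      mul_sub (T - 1), mul_assoc, mul_assoc (T - 1)]

theorem exists_sub_eq_three_term {m : ℕ} (hm : 1 ≤ m) {X X' : Sums} (hX : X ∈ RPos m)
    (h : IsCompatible m X) (hX' : X' ∈ RPos m) (h' : IsCompatible m X') :
    ∃ W ∈ RPos m, X - X' = (1 - T - T') * W := by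
  obtain ⟨-, Y, -, h1⟩ := h
  obtain ⟨-, Y', -, h2⟩ := h'
  refine exists_eq_three_term_mul hm (RPos_sub hX hX') ⟨Y' - Y, ?_⟩
  rw [mul_sub, mul_sub, ← h1, ← h2]
  abel

/-! ### Matrices with nonnegative entries on the cut plane -/

/-- Matrices with nonnegative entries and positive determinant. -/
def IsPositive (A : Matrix (Fin 2) (Fin 2) ℤ) : Prop := (∀ i j, 0 ≤ A i j) ∧ 0 < A.det

/-- The denominator `cz + d`. -/
def den (A : Matrix (Fin 2) (Fin 2) ℤ) (z : ℂ) : ℂ := (A 1 0 : ℂ) * z + (A 1 1 : ℂ)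

/-- The numerator `az + b`. -/
def num (A : Matrix (Fin 2) (Fin 2) ℤ) (z : ℂ) : ℂ := (A 0 0 : ℂ) * z + (A 0 1 : ℂ)

/-- The action by linear fractional transformations. -/
def moeb (A : Matrix (Fin 2) (Fin 2) ℤ) (z : ℂ) : ℂ := num A z / den A z

theorem slashMat_eq (w : ℂ) (F : ℂ → ℂ) (A : Matrix (Fin 2) (Fin 2) ℤ) (z : ℂ) :
    slashMat w F A z = ((|A.det| : ℤ) : ℂ) ^ (w / 2) * den A z ^ (-w) * F (moeb A z) := rfl

theorem slash_eq_lin (w : ℂ) (F : ℂ → ℂ) (X : Sums) (z : ℂ) :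
    slash w F X z = lin (fun g => slashMat w F (rep g) z) X := rfl

theorem IsPositive.mul {A B : Matrix (Fin 2) (Fin 2) ℤ} (hA : IsPositive A) (hB : IsPositive B) :
    IsPositive (A * B) := by
  refine ⟨fun i j => ?_, ?_⟩
  · rw [Matrix.mul_apply]
    exact Finset.sum_nonneg fun k _ => mul_nonneg (hA.1 i k) (hB.1 k j)
  · rw [Matrix.det_mul]
    exact mul_pos hA.2 hB.2

theorem isPositive_rep {m : ℕ} (hm : 1 ≤ m) {g : MatPM} (hg : g ∈ matSetPos m) :
    IsPositive (rep g) := by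
  obtain ⟨A, hA, h0, rfl⟩ := hg
  rw [rep_cls A h0]
  exact ⟨h0, by lia⟩

theorem rep_mul {g h : MatPM} (hg : IsPositive (rep g)) (hh : IsPositive (rep h)) :
    rep (g * h) = rep g * rep h := by
  have h1 : g * h = cls (rep g * rep h) := by
    conv_lhs => rw [← cls_rep g, ← cls_rep h]
    rfl
  rw [h1, rep_cls _ (hg.mul hh).1]

/-- `p` lies in the cut plane, in the closed half plane of `z`. -/
def SameSide (z p : ℂ) : Prop :=
  p ∈ Complex.slitPlane ∧ (0 ≤ z.im → 0 ≤ p.im) ∧ (z.im ≤ 0 → p.im ≤ 0)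

theorem sameSide_linear {z : ℂ} (hz : z ∈ Complex.slitPlane) {a b : ℝ} (ha : 0 ≤ a) (hb : 0 ≤ b)
    (hab : 0 < a + b) : SameSide z (a * z + b) := by
  have him : ((a : ℂ) * z + b).im = a * z.im := by simp
  have hre : ((a : ℂ) * z + b).re = a * z.re + b := by simp
  refine ⟨?_, fun h => ?_, fun h => ?_⟩
  · rw [Complex.mem_slitPlane_iff, him, hre]
    rcases ha.eq_or_lt with rfl | ha'
    · left
      linarith
    · rcases Complex.mem_slitPlane_iff.1 hz with h | h
      · left
        positivity
      · right
        exact mul_ne_zero ha'.ne' h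
  · rw [him]
    positivity
  · rw [him]
    exact mul_nonpos_of_nonneg_of_nonpos ha h

theorem sameSide_trans {z p q : ℂ} (h1 : SameSide z p) (h2 : SameSide p q) : SameSide z q :=
  ⟨h2.1, fun h => h2.2.1 (h1.2.1 h), fun h => h2.2.2 (h1.2.2 h)⟩

theorem IsPositive.row_pos {A : Matrix (Fin 2) (Fin 2) ℤ} (hA : IsPositive A) (i : Fin 2) :
    0 < A i 0 + A i 1 := by
  have h := PeriodHecke.row_pos (m := A.det.toNat) (by have := hA.2; lia)
    ⟨hA.1 0 0, hA.1 0 1, hA.1 1 0, hA.1 1 1⟩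
    (by rw [← Matrix.det_fin_two, Int.toNat_of_nonneg hA.2.le])
  fin_cases i
  · exact h.1
  · exact h.2

theorem sameSide_den {A : Matrix (Fin 2) (Fin 2) ℤ} (hA : IsPositive A) {z : ℂ}
    (hz : z ∈ Complex.slitPlane) : SameSide z (den A z) := by
  have h := sameSide_linear hz (a := A 1 0) (b := A 1 1) (by exact_mod_cast hA.1 1 0)
    (by exact_mod_cast hA.1 1 1) (by exact_mod_cast hA.row_pos 1)
  simpa [den] using h

theorem sameSide_num {A : Matrix (Fin 2) (Fin 2) ℤ} (hA : IsPositive A) {z : ℂ}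
    (hz : z ∈ Complex.slitPlane) : SameSide z (num A z) := by
  have h := sameSide_linear hz (a := A 0 0) (b := A 0 1) (by exact_mod_cast hA.1 0 0)
    (by exact_mod_cast hA.1 0 1) (by exact_mod_cast hA.row_pos 0)
  simpa [num] using h

theorem moeb_im (A : Matrix (Fin 2) (Fin 2) ℤ) (z : ℂ) :
    (moeb A z).im = A.det * z.im / Complex.normSq (den A z) := by
  have h : (num A z).im * (den A z).re - (num A z).re * (den A z).im = A.det * z.im := by
    simp only [num, den, Complex.add_im, Complex.mul_im, Complex.intCast_re, Complex.intCast_im,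
      Complex.add_re, Complex.mul_re, Matrix.det_fin_two]
    push_cast
    ring
  rw [moeb, Complex.div_im, ← sub_div, h]

theorem moeb_re (A : Matrix (Fin 2) (Fin 2) ℤ) (z : ℂ) :
    (moeb A z).re = (A 0 0 * A 1 0 * Complex.normSq z + A 0 1 * A 1 1 +
      (A 0 0 * A 1 1 + A 0 1 * A 1 0) * z.re) / Complex.normSq (den A z) := by
  have h : (num A z).re * (den A z).re + (num A z).im * (den A z).im =
      A 0 0 * A 1 0 * Complex.normSq z + A 0 1 * A 1 1 +
      (A 0 0 * A 1 1 + A 0 1 * A 1 0) * z.re := by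
    simp only [num, den, Complex.add_im, Complex.mul_im, Complex.intCast_re, Complex.intCast_im,
      Complex.add_re, Complex.mul_re, Complex.normSq_apply]
    ring
  rw [moeb, Complex.div_re, ← add_div, h]

theorem IsPositive.diag_pos {A : Matrix (Fin 2) (Fin 2) ℤ} (hA : IsPositive A) :
    0 < A 0 0 ∧ 0 < A 1 1 := by
  have h := hA.2
  rw [Matrix.det_fin_two] at h
  have h1 := mul_nonneg (hA.1 0 1) (hA.1 1 0)
  have h2 : 0 < A 0 0 * A 1 1 := by linarith
  exact ⟨pos_of_mul_pos_left h2 (hA.1 1 1), pos_of_mul_pos_right h2 (hA.1 0 0)⟩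

theorem sameSide_moeb {A : Matrix (Fin 2) (Fin 2) ℤ} (hA : IsPositive A) {z : ℂ}
    (hz : z ∈ Complex.slitPlane) : SameSide z (moeb A z) := by
  have hden : 0 < Complex.normSq (den A z) :=
    Complex.normSq_pos.2 (Complex.slitPlane_ne_zero (sameSide_den hA hz).1)
  have hdet : (0 : ℝ) < A.det := by exact_mod_cast hA.2
  refine ⟨?_, fun h => ?_, fun h => ?_⟩
  · rw [Complex.mem_slitPlane_iff]
    by_cases h : z.im = 0
    · left
      have hre : 0 < z.re := by
        rcases Complex.mem_slitPlane_iff.1 hz with h1 | h1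
        · exact h1
        · exact absurd h h1
      have h00 : (0 : ℝ) < A 0 0 := by exact_mod_cast hA.diag_pos.1
      have h11 : (0 : ℝ) < A 1 1 := by exact_mod_cast hA.diag_pos.2
      have h01 : (0 : ℝ) ≤ A 0 1 := by exact_mod_cast hA.1 0 1
      have h10 : (0 : ℝ) ≤ A 1 0 := by exact_mod_cast hA.1 1 0
      have := Complex.normSq_nonneg z
      rw [moeb_re]
      positivity
    · right
      rw [moeb_im]
      exact div_ne_zero (mul_ne_zero hdet.ne' h) hden.ne'
  · rw [moeb_im]
    positivity
  · rw [moeb_im]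
    exact div_nonpos_of_nonpos_of_nonneg (mul_nonpos_of_nonneg_of_nonpos hdet.le h) hden.le

theorem arg_add_arg_lt_pi {p q : ℂ} (hp : 0 ≤ p.im) (hq : 0 ≤ q.im)
    (hpq : 0 ≤ (p * q).im) (hps : p ∈ Complex.slitPlane) (hqs : q ∈ Complex.slitPlane)
    (hpqs : p * q ∈ Complex.slitPlane) : p.arg + q.arg < Real.pi := by
  have hp1 := Complex.arg_nonneg_iff.2 hp
  have hq1 := Complex.arg_nonneg_iff.2 hq
  have hp2 := lt_of_le_of_ne (Complex.arg_le_pi p) (Complex.mem_slitPlane_iff_arg.1 hps).1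
  have hq2 := lt_of_le_of_ne (Complex.arg_le_pi q) (Complex.mem_slitPlane_iff_arg.1 hqs).1
  have h0 := Complex.slitPlane_ne_zero hps
  have h1 := Complex.slitPlane_ne_zero hqs
  by_contra! h
  have e := Complex.arg_mul_coe_angle h0 h1
  rw [← Real.Angle.coe_add, Real.Angle.angle_eq_iff_two_pi_dvd_sub] at e
  obtain ⟨k, hk⟩ := e
  have h3 := Complex.arg_nonneg_iff.2 hpq
  have h4 := lt_of_le_of_ne (Complex.arg_le_pi (p * q)) (Complex.mem_slitPlane_iff_arg.1 hpqs).1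
  have hpi := Real.pi_pos
  have k1 : (k : ℝ) < 0 := by nlinarith
  have k2 : (-1 : ℝ) < k := by nlinarith
  have k3 : k < 0 := by exact_mod_cast k1
  have k4 : -1 < k := by exact_mod_cast k2
  lia

theorem mul_cpow_of_sameSide {z p q : ℂ} (hp : SameSide z p) (hq : SameSide z q)
    (hpq : SameSide z (p * q)) (w : ℂ) : (p * q) ^ w = p ^ w * q ^ w := by
  have h0 := Complex.slitPlane_ne_zero hp.1
  have h1 := Complex.slitPlane_ne_zero hq.1
  have hpi := Real.pi_pos
  have harg : p.arg + q.arg ∈ Set.Ioc (-Real.pi) Real.pi := by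
    rcases le_total 0 z.im with h | h
    · have h2 := arg_add_arg_lt_pi (hp.2.1 h) (hq.2.1 h) (hpq.2.1 h) hp.1 hq.1 hpq.1
      have h3 := Complex.arg_nonneg_iff.2 (hp.2.1 h)
      have h4 := Complex.arg_nonneg_iff.2 (hq.2.1 h)
      exact ⟨by linarith, h2.le⟩
    · have hconj {v : ℂ} (hv : v ∈ Complex.slitPlane) :
          (starRingEnd ℂ) v ∈ Complex.slitPlane := by
        rw [Complex.mem_slitPlane_iff] at hv ⊢
        simpa using hv
      have hconj' {v : ℂ} (hv : v ∈ Complex.slitPlane) : ((starRingEnd ℂ) v).arg = -v.arg := by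
        rw [Complex.arg_conj, if_neg (Complex.mem_slitPlane_iff_arg.1 hv).1]
      have h2 := arg_add_arg_lt_pi (p := (starRingEnd ℂ) p) (q := (starRingEnd ℂ) q)
        (by simpa using hp.2.2 h) (by simpa using hq.2.2 h)
        (by rw [← map_mul, Complex.conj_im]; linarith [hpq.2.2 h]) (hconj hp.1) (hconj hq.1)
        (by rw [← map_mul]; exact hconj hpq.1)
      have h3 : p.arg ≤ 0 := by
        have := Complex.arg_nonneg_iff.2 (show 0 ≤ ((starRingEnd ℂ) p).im by
          simpa using hp.2.2 h)
        rw [hconj' hp.1] at this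
        linarith
      have h4 : q.arg ≤ 0 := by
        have := Complex.arg_nonneg_iff.2 (show 0 ≤ ((starRingEnd ℂ) q).im by
          simpa using hq.2.2 h)
        rw [hconj' hq.1] at this
        linarith
      rw [hconj' hp.1, hconj' hq.1] at h2
      exact ⟨by linarith, by linarith⟩
  rw [Complex.cpow_def_of_ne_zero (mul_ne_zero h0 h1), Complex.cpow_def_of_ne_zero h0,
    Complex.cpow_def_of_ne_zero h1, Complex.log_mul h0 h1 harg, add_mul, Complex.exp_add]

theorem den_mul {A B : Matrix (Fin 2) (Fin 2) ℤ} {z : ℂ} (hz : den B z ≠ 0) :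
    den (A * B) z = den B z * den A (moeb B z) := by
  have h : den B z * den A (moeb B z) = A 1 0 * num B z + A 1 1 * den B z := by
    rw [den.eq_1 A, moeb]
    field_simp
  rw [h]
  simp only [den, num, Matrix.mul_apply, Fin.sum_univ_two]
  push_cast
  ring

theorem num_mul {A B : Matrix (Fin 2) (Fin 2) ℤ} {z : ℂ} (hz : den B z ≠ 0) :
    num (A * B) z = den B z * num A (moeb B z) := by
  have h : den B z * num A (moeb B z) = A 0 0 * num B z + A 0 1 * den B z := by
    rw [num.eq_1 A, moeb]
    field_simp
  rw [h]
  simp only [den, num, Matrix.mul_apply, Fin.sum_univ_two]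
  push_cast
  ring

theorem moeb_mul {A B : Matrix (Fin 2) (Fin 2) ℤ} {z : ℂ} (hz : den B z ≠ 0) :
    moeb (A * B) z = moeb A (moeb B z) := by
  rw [moeb, num_mul hz, den_mul hz, mul_div_mul_left _ _ hz, moeb.eq_1 A]

theorem abs_det_mul_cpow (A B : Matrix (Fin 2) (Fin 2) ℤ) (w : ℂ) :
    ((|(A * B).det| : ℤ) : ℂ) ^ w = ((|A.det| : ℤ) : ℂ) ^ w * ((|B.det| : ℤ) : ℂ) ^ w := by
  rw [Matrix.det_mul, abs_mul, Int.cast_mul]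
  have h := Complex.mul_cpow_ofReal_nonneg (a := ((|A.det| : ℤ) : ℝ)) (b := ((|B.det| : ℤ) : ℝ))
    (by positivity) (by positivity) w
  exact_mod_cast h

theorem slashMat_mul {A B : Matrix (Fin 2) (Fin 2) ℤ} (hA : IsPositive A) (hB : IsPositive B)
    (w : ℂ) (F : ℂ → ℂ) {z : ℂ} (hz : z ∈ Complex.slitPlane) :
    slashMat w F (A * B) z = slashMat w (slashMat w F A) B z := by
  have hd := sameSide_den hB hz
  have hm := sameSide_moeb hB hz
  have h0 := Complex.slitPlane_ne_zero hd.1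
  have h1 : SameSide z (den A (moeb B z)) := sameSide_trans hm (sameSide_den hA hm.1)
  have h2 := sameSide_den (hA.mul hB) hz
  rw [den_mul h0] at h2
  rw [slashMat_eq, slashMat_eq, slashMat_eq, abs_det_mul_cpow, den_mul h0, moeb_mul h0,
    mul_cpow_of_sameSide hd h1 h2]
  ring

theorem differentiableOn_slashMat {A : Matrix (Fin 2) (Fin 2) ℤ} (hA : IsPositive A) (w : ℂ)
    {F : ℂ → ℂ} (hF : DifferentiableOn ℂ F Complex.slitPlane) :
    DifferentiableOn ℂ (slashMat w F A) Complex.slitPlane := by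
  have hnum : DifferentiableOn ℂ (num A) Complex.slitPlane := by
    unfold num
    fun_prop
  have hden : DifferentiableOn ℂ (den A) Complex.slitPlane := by
    unfold den
    fun_prop
  have hmoeb : DifferentiableOn ℂ (moeb A) Complex.slitPlane :=
    hnum.div hden fun z hz => Complex.slitPlane_ne_zero (sameSide_den hA hz).1
  exact ((hden.cpow_const fun z hz => (sameSide_den hA hz).1).const_mul _).mul
    (hF.comp hmoeb fun z hz => (sameSide_moeb hA hz).1)

/-! ### The action on period-like functions -/

theorem ext_slashCut (w : ℂ) (ψ : Complex.slitPlane → ℂ) (X : Sums) {z : ℂ}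
    (hz : z ∈ Complex.slitPlane) : ext (slashCut w ψ X) z = slash w (ext ψ) X z := by
  simp [ext, hz, slashCut]

theorem isPositive_of_nonneg {a b c d : ℤ} (h0 : 0 ≤ a ∧ 0 ≤ b ∧ 0 ≤ c ∧ 0 ≤ d)
    (h1 : 0 < a * d - b * c) : IsPositive !![a, b; c, d] := by
  refine ⟨fun i j => ?_, by rwa [Matrix.det_fin_two_of]⟩
  obtain ⟨ha, hb, hc, hd⟩ := h0
  fin_cases i <;> fin_cases j <;> simpa

theorem slash_mul_mat {m : ℕ} (hm : 1 ≤ m) {X : Sums} (hX : X ∈ RPos m) (w : ℂ) (F : ℂ → ℂ)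
    {a b c d : ℤ} (h0 : 0 ≤ a ∧ 0 ≤ b ∧ 0 ≤ c ∧ 0 ≤ d) (h1 : 0 < a * d - b * c)
    {z : ℂ} (hz : z ∈ Complex.slitPlane) :
    slash w F (X * mat a b c d) z = slashMat w (slash w F X) !![a, b; c, d] z := by
  have hB := isPositive_of_nonneg h0 h1
  have hrep := rep_cls_of_nonneg h0.1 h0.2.1 h0.2.2.1 h0.2.2.2
  rw [slash_eq_lin, mat, lin_mul_of, slashMat_eq, slash_eq_lin, ← lin_const_mul]
  refine lin_congr fun g hg => ?_
  have hA := isPositive_rep hm (hX g hg)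
  rw [rep_mul hA (hrep.symm ▸ hB), hrep, slashMat_mul hA hB w F hz]
  rfl

theorem slash_mat_mul {m : ℕ} (hm : 1 ≤ m) {X : Sums} (hX : X ∈ RPos m) (w : ℂ) (F : ℂ → ℂ)
    {a b c d : ℤ} (h0 : 0 ≤ a ∧ 0 ≤ b ∧ 0 ≤ c ∧ 0 ≤ d) (h1 : 0 < a * d - b * c)
    {z : ℂ} (hz : z ∈ Complex.slitPlane) :
    slash w F (mat a b c d * X) z = slash w (slashMat w F !![a, b; c, d]) X z := by
  have hB := isPositive_of_nonneg h0 h1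
  have hrep := rep_cls_of_nonneg h0.1 h0.2.1 h0.2.2.1 h0.2.2.2
  rw [slash_eq_lin, mat, lin_of_mul, slash_eq_lin]
  refine lin_congr fun g hg => ?_
  have hA := isPositive_rep hm (hX g hg)
  rw [rep_mul (hrep.symm ▸ hB) hA, hrep, slashMat_mul hB hA w F hz]

theorem slash_sub (w : ℂ) (F : ℂ → ℂ) (X Y : Sums) (z : ℂ) :
    slash w F (X - Y) z = slash w F X z - slash w F Y z :=
  map_sub (lin fun g => slashMat w F (rep g) z) X Y

theorem slashMat_T (w : ℂ) (F : ℂ → ℂ) (z : ℂ) : slashMat w F !![1, 1; 0, 1] z = F (z + 1) := by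
  simp [slashMat, Matrix.det_fin_two_of]

theorem slashMat_T' (w : ℂ) (F : ℂ → ℂ) (z : ℂ) :
    slashMat w F !![1, 0; 1, 1] z = (z + 1) ^ (-w) * F (z / (z + 1)) := by
  simp [slashMat, Matrix.det_fin_two_of]

theorem slash_three_term_mul {m : ℕ} (hm : 1 ≤ m) {W : Sums} (hW : W ∈ RPos m) {w : ℂ}
    {F : ℂ → ℂ}
    (hF : ∀ z ∈ Complex.slitPlane, F z = F (z + 1) + (z + 1) ^ (-w) * F (z / (z + 1)))
    {z : ℂ} (hz : z ∈ Complex.slitPlane) : slash w F ((1 - T - T') * W) z = 0 := by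
  rw [sub_mul, sub_mul, one_mul, slash_sub, slash_sub, T, T',
    slash_mat_mul hm hW w F (by norm_num) (by norm_num) hz,
    slash_mat_mul hm hW w F (by norm_num) (by norm_num) hz, slash_eq_lin, slash_eq_lin,
    slash_eq_lin, ← lin_sub_fun, ← lin_sub_fun]
  have h : ∀ g, W.coeff g ≠ 0 → slashMat w F (rep g) z -
      slashMat w (slashMat w F !![1, 1; 0, 1]) (rep g) z -
      slashMat w (slashMat w F !![1, 0; 1, 1]) (rep g) z = 0 := by
    intro g hg
    have hA := isPositive_rep hm (hW g hg)
    rw [slashMat_eq w F, slashMat_eq w (slashMat w F _), slashMat_eq w (slashMat w F _),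
      slashMat_T, slashMat_T', hF _ (sameSide_moeb hA hz).1]
    ring
  rw [lin_congr (φ' := fun _ => (0 : ℂ)) h, lin_apply]
  simp

theorem slashCut_mem_FE {m : ℕ} (hm : 1 ≤ m) {X : Sums} (hX : X ∈ RPos m)
    (hcomp : IsCompatible m X) {s : ℂ} {ψ : Complex.slitPlane → ℂ} (hψ : ψ ∈ FE s) :
    slashCut (2 * s) ψ X ∈ FE s := by
  obtain ⟨hd, hF⟩ := hψ
  rw [neg_mul] at hF
  refine ⟨?_, fun z hz => ?_⟩
  · refine DifferentiableOn.congr (f := slash (2 * s) (ext ψ) X) ?_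
      fun z hz => ext_slashCut _ ψ X hz
    unfold slash Finsupp.sum
    refine DifferentiableOn.fun_sum fun g hg => ?_
    exact (differentiableOn_slashMat
      (isPositive_rep hm (hX g (Finsupp.mem_support_iff.1 hg))) _ hd).const_mul _
  · have hz1 : z + 1 ∈ Complex.slitPlane := by
      simpa using (sameSide_linear hz (a := 1) (b := 1) (by simp) (by simp) (by simp)).1
    have hz2 : z / (z + 1) ∈ Complex.slitPlane := by
      simpa [moeb, num, den] using (sameSide_moeb (A := !![1, 0; 1, 1])
        (isPositive_of_nonneg (by norm_num) (by norm_num)) hz).1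
    obtain ⟨W, hW, hWe⟩ := exists_mul_three_term hm hX hcomp
    have h := slash_three_term_mul hm hW hF hz
    rw [← hWe, mul_sub, mul_sub, mul_one, slash_sub, slash_sub, T, T',
      slash_mul_mat hm hX _ _ (by norm_num) (by norm_num) hz,
      slash_mul_mat hm hX _ _ (by norm_num) (by norm_num) hz, slashMat_T, slashMat_T'] at h
    rw [ext_slashCut _ ψ X hz, ext_slashCut _ ψ X hz1, ext_slashCut _ ψ X hz2, neg_mul]
    linear_combination h

theorem slashCut_eq {m : ℕ} (hm : 1 ≤ m) {X X' : Sums} (hX : X ∈ RPos m)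
    (hcomp : IsCompatible m X) (hX' : X' ∈ RPos m) (hcomp' : IsCompatible m X') {s : ℂ}
    {ψ : Complex.slitPlane → ℂ} (hψ : ψ ∈ FE s) :
    slashCut (2 * s) ψ X = slashCut (2 * s) ψ X' := by
  obtain ⟨W, hW, hWe⟩ := exists_sub_eq_three_term hm hX hcomp hX' hcomp'
  funext z
  have h := slash_three_term_mul hm hW (w := 2 * s) (F := ext ψ)
    (by simpa only [neg_mul] using hψ.2) z.2
  rw [← hWe, slash_sub] at h
  exact sub_eq_zero.1 h

theorem slashCut_add (w : ℂ) (ψ φ : Complex.slitPlane → ℂ) (X : Sums) :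
    slashCut w (ψ + φ) X = slashCut w ψ X + slashCut w φ X := by
  funext z
  rw [Pi.add_apply]
  unfold slashCut
  rw [slash_eq_lin, slash_eq_lin, slash_eq_lin, ← lin_add_fun]
  simp only [slashMat, ext_add, mul_add]

theorem slashCut_smul (w c : ℂ) (ψ : Complex.slitPlane → ℂ) (X : Sums) :
    slashCut w (c • ψ) X = c • slashCut w ψ X := by
  funext z
  rw [Pi.smul_apply, smul_eq_mul]
  unfold slashCut
  rw [slash_eq_lin, slash_eq_lin, ← lin_const_mul]
  refine lin_congr fun g _ => ?_
  simp only [slashMat, ext_smul]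
  ring

/-- The operator on period-like functions given by a formal sum with the compatibility
criterion. -/
def heckeFE {m : ℕ} (hm : 1 ≤ m) {X : Sums} (hX : X ∈ RPos m) (hcomp : IsCompatible m X) (s : ℂ) :
    FE s →ₗ[ℂ] FE s where
  toFun ψ := ⟨slashCut (2 * s) ψ X, slashCut_mem_FE hm hX hcomp ψ.2⟩
  map_add' _ _ := Subtype.ext (slashCut_add _ _ _ _)
  map_smul' _ _ := Subtype.ext (slashCut_smul _ _ _ _)

/-! ### Growth of period functions -/

/-- The growth condition of period functions in a form that is stable under the slash action. -/
def HasGrowth (σ B : ℝ) (F : ℂ → ℂ) : Prop :=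
  ∃ C : ℝ, 0 ≤ C ∧ ∀ z ∈ Complex.slitPlane,
    (z.im ≠ 0 → ‖F z‖ ≤ C * (|z.im| ^ (-B) * max 1 ‖z‖ ^ (2 * B - 2 * σ))) ∧
    (0 ≤ z.re → ‖F z‖ ≤ C * max 1 ‖z‖ ^ (-2 * σ))

theorem rpow_neg_le_bound {A σ y r : ℝ} (hA : 0 < A) (hσ : 0 < σ) (hy : 0 < y) (hyr : y ≤ r) :
    y ^ (-A) ≤ y ^ (-(A + 2 * σ)) * max 1 r ^ (2 * (A + 2 * σ) - 2 * σ) := by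
  have hM : 1 ≤ max 1 r := le_max_left _ _
  have hyM : y ≤ max 1 r := hyr.trans (le_max_right _ _)
  calc y ^ (-A) = y ^ (-(A + 2 * σ)) * y ^ (2 * σ) := by
        rw [← Real.rpow_add hy]
        ring_nf
    _ ≤ y ^ (-(A + 2 * σ)) * max 1 r ^ (2 * σ) := by gcongr
    _ ≤ y ^ (-(A + 2 * σ)) * max 1 r ^ (2 * (A + 2 * σ) - 2 * σ) := by
        gcongr
        linarith

theorem rpow_neg_mul_le_bound {A σ y r : ℝ} (hA : 0 < A) (hσ : 0 < σ) (hy : 0 < y)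
    (hyr : y ≤ r) :
    y ^ (-A) * r ^ (2 * A - 2 * σ) ≤
      y ^ (-(A + 2 * σ)) * max 1 r ^ (2 * (A + 2 * σ) - 2 * σ) := by
  have hr : 0 < r := hy.trans_le hyr
  have hM : 1 ≤ max 1 r := le_max_left _ _
  have hrM : r ≤ max 1 r := le_max_right _ _
  have h1 : r ^ (2 * A - 2 * σ) ≤ y ^ (-(2 * σ)) * max 1 r ^ (2 * A) := by
    rw [sub_eq_add_neg, Real.rpow_add hr, mul_comm]
    have h2 : r ^ (-(2 * σ)) ≤ y ^ (-(2 * σ)) :=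
      Real.rpow_le_rpow_of_nonpos hy hyr (by linarith)
    gcongr
  calc y ^ (-A) * r ^ (2 * A - 2 * σ) ≤ y ^ (-A) * (y ^ (-(2 * σ)) * max 1 r ^ (2 * A)) := by
        gcongr
    _ = y ^ (-(A + 2 * σ)) * max 1 r ^ (2 * A) := by
        rw [← mul_assoc, ← Real.rpow_add hy]
        ring_nf
    _ ≤ y ^ (-(A + 2 * σ)) * max 1 r ^ (2 * (A + 2 * σ) - 2 * σ) := by
        gcongr
        linarith

theorem rpow_max_le_bound {A σ y r : ℝ} (hA : 0 < A) (hσ : 0 < σ) (hy : 0 < y) (hyr : y ≤ r) :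
    max 1 r ^ (-2 * σ) ≤ y ^ (-(A + 2 * σ)) * max 1 r ^ (2 * (A + 2 * σ) - 2 * σ) := by
  have hM : 1 ≤ max 1 r := le_max_left _ _
  have hM0 : 0 < max 1 r := zero_lt_one.trans_le hM
  have hyM : y ≤ max 1 r := hyr.trans (le_max_right _ _)
  calc max 1 r ^ (-2 * σ)
      ≤ max 1 r ^ (-(A + 2 * σ) + (2 * (A + 2 * σ) - 2 * σ)) := by
        gcongr
        linarith
    _ = max 1 r ^ (-(A + 2 * σ)) * max 1 r ^ (2 * (A + 2 * σ) - 2 * σ) := Real.rpow_add hM0 _ _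
    _ ≤ y ^ (-(A + 2 * σ)) * max 1 r ^ (2 * (A + 2 * σ) - 2 * σ) := by
        have h2 : max 1 r ^ (-(A + 2 * σ)) ≤ y ^ (-(A + 2 * σ)) :=
          Real.rpow_le_rpow_of_nonpos hy hyM (by linarith)
        gcongr

theorem IsPeriodFunction.hasGrowth {s : ℂ} (hs : 0 < s.re) {ψ : Complex.slitPlane → ℂ}
    (h : IsPeriodFunction s ψ) : ∃ B, s.re ≤ B ∧ HasGrowth s.re B (ext ψ) := by
  obtain ⟨-, A, hA, C, hC⟩ := h
  have hC0 : 0 ≤ |C| := abs_nonneg C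
  refine ⟨A + 2 * s.re, by linarith, 2 * |C|, by positivity, fun z hz => ?_⟩
  obtain ⟨h1, h2, h3⟩ := hC ⟨z, hz⟩
  simp only at h1 h2 h3
  have hext : ext ψ z = ψ ⟨z, hz⟩ := ext_coe ψ ⟨z, hz⟩
  rw [hext]
  have hright : 0 ≤ z.re → ‖ψ ⟨z, hz⟩‖ ≤ |C| * max 1 ‖z‖ ^ (-2 * s.re) := by
    intro hre
    rcases le_total ‖z‖ 1 with hn | hn
    · rw [max_eq_left hn, Real.one_rpow, mul_one]
      exact (h2 hre hn).trans (le_abs_self C)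
    · rw [max_eq_right hn]
      refine (h3 hre hn).trans ?_
      gcongr
      exact le_abs_self C
  refine ⟨fun him => ?_, fun hre => (hright hre).trans ?_⟩
  · have hy : 0 < |z.im| := abs_pos.2 him
    have hyr := Complex.abs_im_le_norm z
    rcases le_total z.re 0 with hre | hre
    · calc ‖ψ ⟨z, hz⟩‖ ≤ C * (|z.im| ^ (-A) * (1 + ‖z‖ ^ (2 * A - 2 * s.re))) := h1 hre
        _ ≤ |C| * (|z.im| ^ (-A) * (1 + ‖z‖ ^ (2 * A - 2 * s.re))) := by
          gcongr
          exact le_abs_self C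
        _ = |C| * (|z.im| ^ (-A) + |z.im| ^ (-A) * ‖z‖ ^ (2 * A - 2 * s.re)) := by ring
        _ ≤ |C| * (|z.im| ^ (-(A + 2 * s.re)) * max 1 ‖z‖ ^ (2 * (A + 2 * s.re) - 2 * s.re) +
            |z.im| ^ (-(A + 2 * s.re)) * max 1 ‖z‖ ^ (2 * (A + 2 * s.re) - 2 * s.re)) := by
          have e1 := rpow_neg_le_bound hA hs hy hyr
          have e2 := rpow_neg_mul_le_bound hA hs hy hyr
          gcongr
        _ = _ := by ring
    · refine (hright hre).trans ?_
      have e1 := rpow_max_le_bound hA hs hy hyr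
      gcongr
      linarith
  · gcongr
    linarith

theorem isPeriodFunction_of_hasGrowth {s : ℂ} {B : ℝ} (hs : 0 < s.re) (hB : s.re ≤ B)
    {ψ : Complex.slitPlane → ℂ} (hψ : ψ ∈ FE s) (h : HasGrowth s.re B (ext ψ)) :
    IsPeriodFunction s ψ := by
  obtain ⟨C, hC0, hC⟩ := h
  refine ⟨hψ, B, by linarith, C, fun z => ⟨fun hre => ?_, fun hre hn => ?_, fun hre hn => ?_⟩⟩
  · have him : (z : ℂ).im ≠ 0 := by
      rcases Complex.mem_slitPlane_iff.1 z.2 with h | h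
      · linarith
      · exact h
    have h1 := (hC z z.2).1 him
    rw [ext_coe] at h1
    refine h1.trans ?_
    gcongr
    rcases le_total ‖(z : ℂ)‖ 1 with hn | hn
    · rw [max_eq_left hn, Real.one_rpow]
      have : 0 ≤ ‖(z : ℂ)‖ ^ (2 * B - 2 * s.re) := by positivity
      linarith
    · rw [max_eq_right hn]
      linarith
  · have h1 := (hC z z.2).2 hre
    rw [ext_coe, max_eq_left hn, Real.one_rpow, mul_one] at h1
    exact h1
  · have h1 := (hC z z.2).2 hre
    rwa [ext_coe, max_eq_right hn] at h1

theorem norm_cpow_neg_two_mul_le (p s : ℂ) (hp : p ≠ 0) :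
    ‖p ^ (-(2 * s))‖ ≤ Real.exp (2 * Real.pi * |s.im|) * ‖p‖ ^ (-(2 * s.re)) := by
  rw [Complex.norm_cpow_of_ne_zero hp, div_eq_mul_inv, ← Real.exp_neg, mul_comm]
  have h1 : (-(2 * s)).re = -(2 * s.re) := by simp
  have h2 : (-(2 * s)).im = -(2 * s.im) := by simp
  rw [h1, h2]
  gcongr
  have h3 := Complex.abs_arg_le_pi p
  calc -(p.arg * -(2 * s.im)) = 2 * (p.arg * s.im) := by ring
    _ ≤ 2 * |p.arg * s.im| := by
      gcongr
      exact le_abs_self _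
    _ = 2 * (|p.arg| * |s.im|) := by rw [abs_mul]
    _ ≤ 2 * (Real.pi * |s.im|) := by gcongr
    _ = 2 * Real.pi * |s.im| := by ring

theorem max_one_norm_moeb {P N : ℝ} (hP : 0 < P) : max 1 (N / P) = max P N / P := by
  rw [← div_self hP.ne', max_div_div_right hP.le]

theorem norm_linear_le {a b : ℤ} (ha : 0 ≤ a) (hb : 0 ≤ b) (z : ℂ) :
    ‖(a : ℂ) * z + b‖ ≤ (a + b) * max 1 ‖z‖ := by
  have ha' : (0 : ℝ) ≤ a := by exact_mod_cast ha
  have hb' : (0 : ℝ) ≤ b := by exact_mod_cast hb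
  calc ‖(a : ℂ) * z + b‖ ≤ ‖(a : ℂ) * z‖ + ‖(b : ℂ)‖ := norm_add_le _ _
    _ = a * ‖z‖ + b * 1 := by
      rw [norm_mul, Complex.norm_intCast, Complex.norm_intCast, abs_of_nonneg ha',
        abs_of_nonneg hb', mul_one]
    _ ≤ a * max 1 ‖z‖ + b * max 1 ‖z‖ := by
      gcongr
      · exact le_max_right _ _
      · exact le_max_left _ _
    _ = _ := by ring

theorem max_one_le_max_den_num {A : Matrix (Fin 2) (Fin 2) ℤ} (hA : IsPositive A) {z : ℂ}
    (hz : 0 ≤ z.re) : max 1 ‖z‖ ≤ max ‖den A z‖ ‖num A z‖ := by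
  have h00 : (1 : ℝ) ≤ A 0 0 := by exact_mod_cast hA.diag_pos.1
  have h11 : (1 : ℝ) ≤ A 1 1 := by exact_mod_cast hA.diag_pos.2
  have h01 : (0 : ℝ) ≤ A 0 1 := by exact_mod_cast hA.1 0 1
  have h10 : (0 : ℝ) ≤ A 1 0 := by exact_mod_cast hA.1 1 0
  refine max_le_max ?_ ?_
  · refine le_trans ?_ (Complex.re_le_norm _)
    have : (den A z).re = A 1 0 * z.re + A 1 1 := by simp [den]
    rw [this]
    nlinarith [mul_nonneg h10 hz]
  · have hre : (num A z).re = A 0 0 * z.re + A 0 1 := by simp [num]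
    have him : (num A z).im = A 0 0 * z.im := by simp [num]
    rw [← sq_le_sq₀ (norm_nonneg _) (norm_nonneg _), Complex.sq_norm, Complex.sq_norm,
      Complex.normSq_apply, Complex.normSq_apply, hre, him]
    have h2 : z.re ≤ A 0 0 * z.re + A 0 1 := by nlinarith
    have h3 : 1 * (z.im * z.im) ≤ (A 0 0 * A 0 0) * (z.im * z.im) := by
      gcongr
      · exact mul_self_nonneg _
      · nlinarith
    nlinarith

theorem HasGrowth.slash_matrix {s : ℂ} {B : ℝ} (hs : 0 < s.re) (hB : s.re ≤ B) {F : ℂ → ℂ}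
    (h : HasGrowth s.re B F) {A : Matrix (Fin 2) (Fin 2) ℤ} (hA : IsPositive A) :
    HasGrowth s.re B (slashMat (2 * s) F A) := by
  obtain ⟨C, hC0, hC⟩ := h
  set K := Real.exp (2 * Real.pi * |s.im|) with hK
  set D : ℝ := (A.det : ℝ) with hD
  have hD0 : 0 < D := Int.cast_pos.2 hA.2
  set N₀ := ‖((|A.det| : ℤ) : ℂ) ^ (2 * s / 2)‖ with hN₀
  set L : ℝ := A 0 0 + A 0 1 + (A 1 0 + A 1 1) with hL
  have hr0 : (0 : ℝ) < A 0 0 + A 0 1 := by exact_mod_cast hA.row_pos 0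
  have hr1 : (0 : ℝ) < A 1 0 + A 1 1 := by exact_mod_cast hA.row_pos 1
  have hL0 : 0 < L := by positivity
  refine ⟨N₀ * K * C * (1 + D ^ (-B) * L ^ (2 * B - 2 * s.re)), by positivity, fun z hz => ?_⟩
  have hp0 := Complex.slitPlane_ne_zero (sameSide_den hA hz).1
  have hP : 0 < ‖den A z‖ := norm_pos_iff.2 hp0
  set P := ‖den A z‖ with hPdef
  set N := ‖num A z‖ with hNdef
  have hPN : 0 < max P N := lt_max_of_lt_left hP
  obtain ⟨h1, h2⟩ := hC _ (sameSide_moeb hA hz).1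
  have hmoeb : ‖moeb A z‖ = N / P := norm_div _ _
  have hbase : ‖slashMat (2 * s) F A z‖ ≤ N₀ * (K * P ^ (-(2 * s.re))) * ‖F (moeb A z)‖ := by
    rw [slashMat_eq, norm_mul, norm_mul]
    gcongr
    exact norm_cpow_neg_two_mul_le _ s hp0
  rw [hmoeb, max_one_norm_moeb hP] at h1 h2
  refine ⟨fun him => ?_, fun hre => ?_⟩
  · have hy : 0 < |z.im| := abs_pos.2 him
    have himeq : |(moeb A z).im| = D * |z.im| / P ^ 2 := by
      rw [moeb_im, abs_div, abs_mul, abs_of_pos hD0, Complex.normSq_eq_norm_sq,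
        abs_of_nonneg (sq_nonneg ‖den A z‖)]
    have him' : (moeb A z).im ≠ 0 := by
      rw [← abs_pos, himeq]
      positivity
    have h3 := h1 him'
    rw [himeq] at h3
    have hPLM : max P N ≤ L * max 1 ‖z‖ := by
      have e1 : P ≤ (A 1 0 + A 1 1) * max 1 ‖z‖ := norm_linear_le (hA.1 1 0) (hA.1 1 1) z
      have e2 : N ≤ (A 0 0 + A 0 1) * max 1 ‖z‖ := norm_linear_le (hA.1 0 0) (hA.1 0 1) z
      have e3 : 0 < max 1 ‖z‖ := zero_lt_one.trans_le (le_max_left _ _)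
      have e4 : 0 < (A 1 0 + A 1 1 : ℝ) * max 1 ‖z‖ := by positivity
      have e5 : 0 < (A 0 0 + A 0 1 : ℝ) * max 1 ‖z‖ := by positivity
      refine max_le ?_ ?_ <;> rw [hL, add_mul] <;> linarith
    have hexp : P ^ (-(2 * s.re)) * ((D * |z.im| / P ^ 2) ^ (-B) *
        (max P N / P) ^ (2 * B - 2 * s.re)) =
        D ^ (-B) * (|z.im| ^ (-B) * max P N ^ (2 * B - 2 * s.re)) := by
      rw [Real.div_rpow (by positivity) (by positivity), Real.mul_rpow hD0.le hy.le,
        Real.div_rpow hPN.le hP.le, ← Real.rpow_natCast, ← Real.rpow_mul hP.le]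
      have e : P ^ (-(2 * s.re)) = P ^ (((2 : ℕ) : ℝ) * -B) * P ^ (2 * B - 2 * s.re) := by
        rw [← Real.rpow_add hP]
        push_cast
        ring_nf
      have e1 : P ^ (((2 : ℕ) : ℝ) * -B) ≠ 0 := (Real.rpow_pos_of_pos hP _).ne'
      have e2 : P ^ (2 * B - 2 * s.re) ≠ 0 := (Real.rpow_pos_of_pos hP _).ne'
      rw [e]
      field_simp
    calc ‖slashMat (2 * s) F A z‖ ≤ N₀ * (K * P ^ (-(2 * s.re))) * ‖F (moeb A z)‖ := hbase
      _ ≤ N₀ * (K * P ^ (-(2 * s.re))) * (C * ((D * |z.im| / P ^ 2) ^ (-B) *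
        (max P N / P) ^ (2 * B - 2 * s.re))) := by gcongr
      _ = N₀ * K * C * (P ^ (-(2 * s.re)) * ((D * |z.im| / P ^ 2) ^ (-B) *
        (max P N / P) ^ (2 * B - 2 * s.re))) := by ring
      _ = N₀ * K * C * (D ^ (-B) * (|z.im| ^ (-B) * max P N ^ (2 * B - 2 * s.re))) := by rw [hexp]
      _ ≤ N₀ * K * C * (D ^ (-B) * (|z.im| ^ (-B) *
          (L * max 1 ‖z‖) ^ (2 * B - 2 * s.re))) := by
        gcongr
        linarith
      _ = N₀ * K * C * (D ^ (-B) * L ^ (2 * B - 2 * s.re)) *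
          (|z.im| ^ (-B) * max 1 ‖z‖ ^ (2 * B - 2 * s.re)) := by
        rw [Real.mul_rpow hL0.le (by positivity)]
        ring
      _ ≤ _ := by
        gcongr
        linarith
  · have hre' : 0 ≤ (moeb A z).re := by
      have h00 : (0 : ℝ) ≤ A 0 0 := by exact_mod_cast hA.1 0 0
      have h11 : (0 : ℝ) ≤ A 1 1 := by exact_mod_cast hA.1 1 1
      have h01 : (0 : ℝ) ≤ A 0 1 := by exact_mod_cast hA.1 0 1
      have h10 : (0 : ℝ) ≤ A 1 0 := by exact_mod_cast hA.1 1 0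
      have := Complex.normSq_nonneg z
      have := Complex.normSq_nonneg (den A z)
      rw [moeb_re]
      positivity
    have h3 := h2 hre'
    have hexp : P ^ (-(2 * s.re)) * (max P N / P) ^ (-2 * s.re) = max P N ^ (-2 * s.re) := by
      rw [Real.div_rpow hPN.le hP.le, neg_mul]
      have e2 : P ^ (-(2 * s.re)) ≠ 0 := (Real.rpow_pos_of_pos hP _).ne'
      field_simp
    calc ‖slashMat (2 * s) F A z‖ ≤ N₀ * (K * P ^ (-(2 * s.re))) * ‖F (moeb A z)‖ := hbase
      _ ≤ N₀ * (K * P ^ (-(2 * s.re))) * (C * (max P N / P) ^ (-2 * s.re)) := by gcongr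
      _ = N₀ * K * C * (P ^ (-(2 * s.re)) * (max P N / P) ^ (-2 * s.re)) := by ring
      _ = N₀ * K * C * 1 * max P N ^ (-2 * s.re) := by rw [hexp, mul_one]
      _ ≤ N₀ * K * C * 1 * max 1 ‖z‖ ^ (-2 * s.re) := by
        have := Real.rpow_le_rpow_of_nonpos (z := -2 * s.re) (by positivity)
          (max_one_le_max_den_num hA hre) (by linarith)
        gcongr
      _ ≤ _ := by
        gcongr
        have : 0 ≤ D ^ (-B) * L ^ (2 * B - 2 * s.re) := by positivity
        linarith

theorem HasGrowth.zero (σ B : ℝ) : HasGrowth σ B fun _ => 0 :=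
  ⟨0, le_rfl, fun z _ => by simp⟩

theorem HasGrowth.add {σ B : ℝ} {F G : ℂ → ℂ} (hF : HasGrowth σ B F) (hG : HasGrowth σ B G) :
    HasGrowth σ B fun z => F z + G z := by
  obtain ⟨C, hC0, hC⟩ := hF
  obtain ⟨C', hC0', hC'⟩ := hG
  refine ⟨C + C', by positivity, fun z hz => ⟨fun h => ?_, fun h => ?_⟩⟩
  · rw [add_mul]
    exact (norm_add_le _ _).trans (add_le_add ((hC z hz).1 h) ((hC' z hz).1 h))
  · rw [add_mul]
    exact (norm_add_le _ _).trans (add_le_add ((hC z hz).2 h) ((hC' z hz).2 h))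

theorem HasGrowth.const_mul {σ B : ℝ} {F : ℂ → ℂ} (hF : HasGrowth σ B F) (c : ℂ) :
    HasGrowth σ B fun z => c * F z := by
  obtain ⟨C, hC0, hC⟩ := hF
  refine ⟨‖c‖ * C, by positivity, fun z hz => ⟨fun h => ?_, fun h => ?_⟩⟩
  · rw [norm_mul, mul_assoc]
    exact mul_le_mul_of_nonneg_left ((hC z hz).1 h) (norm_nonneg c)
  · rw [norm_mul, mul_assoc]
    exact mul_le_mul_of_nonneg_left ((hC z hz).2 h) (norm_nonneg c)

theorem HasGrowth.sum {ι : Type*} {σ B : ℝ} (t : Finset ι) {F : ι → ℂ → ℂ}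
    (h : ∀ i ∈ t, HasGrowth σ B (F i)) : HasGrowth σ B fun z => ∑ i ∈ t, F i z := by
  classical
  induction t using Finset.induction_on with
  | empty => simpa using HasGrowth.zero σ B
  | insert i t hi ih =>
    simp only [Finset.sum_insert hi]
    exact (h i (Finset.mem_insert_self i t)).add
      (ih fun j hj => h j (Finset.mem_insert_of_mem hj))

theorem HasGrowth.congr {σ B : ℝ} {F G : ℂ → ℂ} (hF : HasGrowth σ B F)
    (h : Set.EqOn F G Complex.slitPlane) : HasGrowth σ B G := by
  obtain ⟨C, hC0, hC⟩ := hF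
  exact ⟨C, hC0, fun z hz => h hz ▸ hC z hz⟩

theorem isPeriodFunction_slashCut {m : ℕ} (hm : 1 ≤ m) {X : Sums} (hX : X ∈ RPos m)
    (hcomp : IsCompatible m X) {s : ℂ} (hs : 0 < s.re) {ψ : Complex.slitPlane → ℂ}
    (hψ : IsPeriodFunction s ψ) : IsPeriodFunction s (slashCut (2 * s) ψ X) := by
  obtain ⟨B, hB, hg⟩ := hψ.hasGrowth hs
  refine isPeriodFunction_of_hasGrowth hs hB (slashCut_mem_FE hm hX hcomp hψ.1) ?_
  refine HasGrowth.congr (F := slash (2 * s) (ext ψ) X) ?_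
    fun z hz => (ext_slashCut _ ψ X hz).symm
  refine HasGrowth.sum _ fun g hg' => HasGrowth.const_mul ?_ _
  exact hg.slash_matrix hs hB (isPositive_rep hm (hX g (Finsupp.mem_support_iff.1 hg')))

/-! ### Hecke operators on Maass cusp forms -/

theorem moeb_neg (A : Matrix (Fin 2) (Fin 2) ℤ) (z : ℂ) : moeb (-A) z = moeb A z := by
  have h1 : num (-A) z = -num A z := by simp [num]; ring
  have h2 : den (-A) z = -den A z := by simp [den]; ring
  rw [moeb, h1, h2, neg_div_neg_eq, moeb]

theorem moeb_rep_cls (A : Matrix (Fin 2) (Fin 2) ℤ) (z : ℂ) : moeb (rep (cls A)) z = moeb A z := by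
  rcases (cls_eq_iff _ _).1 (cls_rep (cls A)) with h | h
  · rw [h]
  · rw [h, moeb_neg]

theorem moeb_rep_mul {g h : MatPM} {z : ℂ} (hz : den (rep h) z ≠ 0) :
    moeb (rep (g * h)) z = moeb (rep g) (moeb (rep h) z) := by
  have h1 : g * h = cls (rep g * rep h) := by
    conv_lhs => rw [← cls_rep g, ← cls_rep h]
    rfl
  rw [h1, moeb_rep_cls, moeb_mul hz]

theorem den_ne_zero {A : Matrix (Fin 2) (Fin 2) ℤ} (hA : A.det ≠ 0) {z : ℂ} (hz : z.im ≠ 0) :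
    den A z ≠ 0 := by
  intro h
  have him : (den A z).im = A 1 0 * z.im := by simp [den]
  have hre : (den A z).re = A 1 0 * z.re + A 1 1 := by simp [den]
  rw [h] at him hre
  simp only [Complex.zero_im, Complex.zero_re] at him hre
  have h10 : (A 1 0 : ℝ) = 0 := by
    rcases mul_eq_zero.1 him.symm with h | h
    · exact h
    · exact absurd h hz
  have h11 : (A 1 1 : ℝ) = 0 := by rw [h10] at hre; linarith
  apply hA
  rw [Matrix.det_fin_two, show A 1 0 = 0 by exact_mod_cast h10,
    show A 1 1 = 0 by exact_mod_cast h11]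
  ring

theorem det_rep_of_mem {m : ℕ} {g : MatPM} (hg : g ∈ matSet m) : (rep g).det = m := by
  obtain ⟨A, hA, rfl⟩ := hg
  rcases (cls_eq_iff _ _).1 (cls_rep (cls A)) with h | h
  · rw [h, hA]
  · rw [h, Matrix.det_neg, hA]
    simp

theorem moeb_im_pos {A : Matrix (Fin 2) (Fin 2) ℤ} (hA : 0 < A.det) {z : ℂ} (hz : 0 < z.im) :
    0 < (moeb A z).im := by
  have h1 : 0 < Complex.normSq (den A z) := Complex.normSq_pos.2 (den_ne_zero hA.ne' hz.ne')
  have h2 : (0 : ℝ) < A.det := Int.cast_pos.2 hA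
  rw [moeb_im]
  positivity

theorem slash_zero_eq_lin (F : ℂ → ℂ) (X : Sums) (z : ℂ) :
    slash 0 F X z = lin (fun g => F (moeb (rep g) z)) X := by
  rw [slash_eq_lin]
  refine lin_congr fun g _ => ?_
  simp [slashMat_eq]

theorem slash_zero_heckeInf (F : ℂ → ℂ) (m : ℕ) (z : ℂ) :
    slash 0 F (heckeInf m) z =
      ∑ p ∈ m.divisorsAntidiagonal, ∑ b ∈ Finset.range p.2, F ((p.1 * z + b) / p.2) := by
  rw [slash_zero_eq_lin, heckeInf, map_sum]
  refine Finset.sum_congr rfl fun p _ => ?_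
  rw [map_sum]
  refine Finset.sum_congr rfl fun b _ => ?_
  rw [lin_mat, moeb_rep_cls]
  simp [moeb, num, den]

/-- Invariance of a function on the upper half plane under the modular group. -/
def IsModular (F : ℂ → ℂ) : Prop :=
  ∀ z : ℂ, 0 < z.im → F (z + 1) = F z ∧ F (-1 / z) = F z

theorem isModular_of_invariant {u : UpperHalfPlane → ℂ}
    (hu : ∀ (g : Matrix.SpecialLinearGroup (Fin 2) ℤ) (z : UpperHalfPlane), u (g • z) = u z) :
    IsModular fun w => u (UpperHalfPlane.ofComplex w) := by
  intro z hz
  lift z to UpperHalfPlane using hz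
  constructor
  · have h := hu ModularGroup.T z
    rw [UpperHalfPlane.modular_T_smul] at h
    beta_reduce
    rw [UpperHalfPlane.ofComplex_apply, ← h, ← UpperHalfPlane.ofComplex_apply ((1 : ℝ) +ᵥ z)]
    congr 2
    simp [add_comm]
  · have h := hu ModularGroup.S z
    rw [UpperHalfPlane.modular_S_smul] at h
    beta_reduce
    rw [UpperHalfPlane.ofComplex_apply, ← h,
      ← UpperHalfPlane.ofComplex_apply (UpperHalfPlane.mk _ _)]
    congr 2
    simp [neg_div, inv_neg]

theorem invariant_of_isModular {F : ℂ → ℂ} (hF : IsModular F)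
    (g : Matrix.SpecialLinearGroup (Fin 2) ℤ) (z : UpperHalfPlane) :
    F ((g • z : UpperHalfPlane) : ℂ) = F z := by
  have hg : g ∈ Subgroup.closure {ModularGroup.S, ModularGroup.T} := by
    rw [SpecialLinearGroup.SL2Z_generators]
    trivial
  induction hg using Subgroup.closure_induction generalizing z with
  | mem x hx =>
    rcases hx with rfl | rfl
    · rw [UpperHalfPlane.modular_S_smul, ← (hF z z.im_pos).2]
      congr 1
      simp [neg_div, inv_neg]
    · rw [UpperHalfPlane.modular_T_smul, ← (hF z z.im_pos).1]
      congr 1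
      simp [add_comm]
  | one => rw [one_smul]
  | mul x y _ _ hx hy => rw [mul_smul, hx, hy]
  | inv x _ hx =>
    have h := hx (x⁻¹ • z)
    rw [smul_inv_smul] at h
    exact h.symm

theorem IsModular.heckeInf {m : ℕ} (hm : 1 ≤ m) {X : Sums} (hX : X ∈ RPos m)
    (hcomp : IsCompatible m X) {F : ℂ → ℂ} (hF : IsModular F) :
    IsModular (slash 0 F (heckeInf m)) := by
  obtain ⟨⟨Y₁, hY₁, h1⟩, Y₂, hY₂, h2⟩ := hcomp
  intro z hz
  have hz0 : z ≠ 0 := by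
    rintro rfl
    simp at hz
  have hdet {g : MatPM} (hg : g ∈ matSet m) : 0 < (rep g).det := by
    rw [det_rep_of_mem hg]
    exact_mod_cast hm
  have hTm (w : ℂ) : moeb (rep (cls !![1, 1; 0, 1])) w = w + 1 := by
    rw [moeb_rep_cls]
    simp [moeb, num, den]
  have hSm (w : ℂ) : moeb (rep (cls !![0, -1; 1, 0])) w = -1 / w := by
    rw [moeb_rep_cls]
    simp [moeb, num, den]
  have hTd : den (rep (cls !![1, 1; 0, 1])) z ≠ 0 := by
    refine den_ne_zero ?_ hz.ne'
    rw [det_rep_of_mem (m := 1) ⟨_, by simp [Matrix.det_fin_two_of], rfl⟩]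
    simp
  have hSd : den (rep (cls !![0, -1; 1, 0])) z ≠ 0 := by
    refine den_ne_zero ?_ hz.ne'
    rw [det_rep_of_mem (m := 1) ⟨_, by simp [Matrix.det_fin_two_of], rfl⟩]
    simp
  have hleft (γ : MatPM) (hγ : γ ∈ matSet 1)
      (hγF : ∀ w : ℂ, 0 < w.im → F (moeb (rep γ) w) = F w) (Y : Sums) (hY : Y ∈ R m) :
      lin (fun g => F (moeb (rep g) z)) ((MonoidAlgebra.of ℤ MatPM γ - 1) * Y) = 0 := by
    rw [sub_mul, one_mul, map_sub, lin_of_mul, sub_eq_zero]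
    refine lin_congr fun g hg => ?_
    rw [moeb_rep_mul (den_ne_zero (hdet (hY g hg)).ne' hz.ne'),
      hγF _ (moeb_im_pos (hdet (hY g hg)) hz)]
  have hT1 : cls !![1, 1; 0, 1] ∈ matSet 1 := ⟨_, by simp [Matrix.det_fin_two_of], rfl⟩
  have hS1 : cls !![0, -1; 1, 0] ∈ matSet 1 := ⟨_, by simp [Matrix.det_fin_two_of], rfl⟩
  have hXR : X ∈ R m := fun g hg => matSetPos_subset m (hX g hg)
  have hT (Y : Sums) (hY : Y ∈ R m) : lin (fun g => F (moeb (rep g) z)) ((T - 1) * Y) = 0 :=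
    hleft _ hT1 (fun w hw => by rw [hTm, (hF w hw).1]) Y hY
  have hS (Y : Sums) (hY : Y ∈ R m) : lin (fun g => F (moeb (rep g) z)) ((S - 1) * Y) = 0 :=
    hleft _ hS1 (fun w hw => by rw [hSm, (hF w hw).2]) Y hY
  constructor
  · have h3 := hT Y₁ hY₁
    rw [← h1, mul_sub, mul_one, map_sub, T, mat, lin_mul_of, sub_eq_zero] at h3
    rw [slash_zero_eq_lin, slash_zero_eq_lin, ← h3]
    refine lin_congr fun g _ => ?_
    rw [moeb_rep_mul hTd, hTm]
  · have h3 := hT Y₂ hY₂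
    rw [← h2, map_sub, hS X hXR, sub_zero, mul_sub, mul_one, map_sub, S, mat, lin_mul_of,
      sub_eq_zero] at h3
    rw [slash_zero_eq_lin, slash_zero_eq_lin, ← h3]
    refine lin_congr fun g _ => ?_
    rw [moeb_rep_mul hSd, hSm]

/-- A real-analytic eigenfunction of the hyperbolic Laplacian on the upper half plane. -/
def IsEigen (s : ℂ) (F : ℂ → ℂ) : Prop :=
  AnalyticOnNhd ℝ F {z | 0 < z.im} ∧
    ∀ z : ℂ, 0 < z.im →
      -((z.im : ℂ) ^ 2) * (Laplacian.laplacian F : ℂ → ℂ) z = s * (1 - s) * F z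

theorem isOpen_im_pos : IsOpen {z : ℂ | 0 < z.im} :=
  isOpen_lt continuous_const Complex.continuous_im

theorem laplacian_comp_affine (F : ℂ → ℂ) {α : ℝ} (hα : α ≠ 0) (β z : ℂ) :
    (Laplacian.laplacian (fun w => F (α * w + β)) : ℂ → ℂ) z =
      (α : ℂ) ^ 2 * (Laplacian.laplacian F : ℂ → ℂ) (α * z + β) := by
  let e : ℂ ≃L[ℝ] ℂ := ContinuousLinearEquiv.smulLeft (Units.mk0 α hα)
  have he (w : ℂ) : e w = α * w := by
    simp [e, Units.smul_def]
  have h1 : (fun w => F (α * w + β)) = (fun w => F (w + β)) ∘ e := by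
    funext w
    simp [he]
  have h2 := ContinuousLinearEquiv.iteratedFDerivWithin_comp_right e (fun w => F (w + β))
    (s := Set.univ) uniqueDiffOn_univ (x := z) (Set.mem_univ _) 2
  rw [Set.preimage_univ, iteratedFDerivWithin_univ, iteratedFDerivWithin_univ,
    iteratedFDeriv_comp_add_right] at h2
  rw [InnerProductSpace.laplacian_eq_iteratedFDeriv_complexPlane,
    InnerProductSpace.laplacian_eq_iteratedFDeriv_complexPlane]
  simp only
  rw [h1, h2, he]
  have h3 (v : ℂ) : (fun i => e ((![v, v] : Fin 2 → ℂ) i)) = fun i => α • ![v, v] i := by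
    funext i
    rw [he, Complex.real_smul]
  have h4 (v : ℂ) : (iteratedFDeriv ℝ 2 F (α * z + β)).compContinuousLinearMap
      (fun _ => (e : ℂ →L[ℝ] ℂ)) ![v, v] =
      (α : ℂ) ^ 2 * iteratedFDeriv ℝ 2 F (α * z + β) ![v, v] := by
    rw [ContinuousMultilinearMap.compContinuousLinearMap_apply]
    change iteratedFDeriv ℝ 2 F (α * z + β) (fun i => e (![v, v] i)) = _
    rw [h3, ContinuousMultilinearMap.map_smul_univ]
    simp [sq]
  rw [h4, h4]
  ring

theorem IsEigen.comp_affine {s : ℂ} {F : ℂ → ℂ} (hF : IsEigen s F) {α β : ℝ} (hα : 0 < α) :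
    IsEigen s fun z => F (α * z + β) := by
  have him (z : ℂ) : ((α : ℂ) * z + β).im = α * z.im := by simp
  refine ⟨?_, fun z hz => ?_⟩
  · refine hF.1.comp (g := F) (f := fun z => α * z + β) ?_ fun z hz => ?_
    · exact (analyticOnNhd_const.mul analyticOnNhd_id).add analyticOnNhd_const
    · change 0 < ((α : ℂ) * z + β).im
      rw [him]
      exact mul_pos hα hz
  · have h := hF.2 (α * z + β) (by rw [him]; positivity)
    rw [laplacian_comp_affine F hα.ne', ← h, him]
    push_cast
    ring

theorem IsEigen.add {s : ℂ} {F G : ℂ → ℂ} (hF : IsEigen s F) (hG : IsEigen s G) :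
    IsEigen s (F + G) := by
  refine ⟨hF.1.add hG.1, fun z hz => ?_⟩
  rw [(hF.1 z hz).contDiffAt.laplacian_add (hG.1 z hz).contDiffAt, mul_add, hF.2 z hz, hG.2 z hz,
    Pi.add_apply]
  ring

theorem IsEigen.zero (s : ℂ) : IsEigen s 0 := by
  refine ⟨analyticOnNhd_const, fun z _ => ?_⟩
  have h : (Laplacian.laplacian (0 : ℂ → ℂ) : ℂ → ℂ) = 0 :=
    InnerProductSpace.laplacian_const (c := (0 : ℂ))
  rw [h]
  simp

theorem IsEigen.sum {ι : Type*} {s : ℂ} (t : Finset ι) {F : ι → ℂ → ℂ}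
    (h : ∀ i ∈ t, IsEigen s (F i)) : IsEigen s (∑ i ∈ t, F i) :=
  Finset.sum_induction F (IsEigen s) (fun _ _ => IsEigen.add) (IsEigen.zero s) h

theorem IsEigen.congr {s : ℂ} {F G : ℂ → ℂ} (hF : IsEigen s F)
    (h : Set.EqOn F G {z | 0 < z.im}) : IsEigen s G := by
  refine ⟨hF.1.congr isOpen_im_pos h, fun z hz => ?_⟩
  have h1 : F =ᶠ[nhds z] G := h.eventuallyEq_of_mem (isOpen_im_pos.mem_nhds hz)
  rw [← (InnerProductSpace.laplacian_congr_nhds h1).eq_of_nhds, hF.2 z hz, h hz]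

theorem IsEigen.heckeInf {s : ℂ} {F : ℂ → ℂ} (hF : IsEigen s F) (m : ℕ) :
    IsEigen s (slash 0 F (heckeInf m)) := by
  have h : slash 0 F (PeriodHecke.heckeInf m) = ∑ p ∈ m.divisorsAntidiagonal,
      ∑ b ∈ Finset.range p.2, fun z =>
        F (((p.1 / p.2 : ℝ) : ℂ) * z + ((b / p.2 : ℝ) : ℂ)) := by
    funext z
    rw [slash_zero_heckeInf, Finset.sum_apply]
    refine Finset.sum_congr rfl fun p _ => ?_
    rw [Finset.sum_apply]
    refine Finset.sum_congr rfl fun b _ => ?_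
    congr 1
    push_cast
    ring
  rw [h]
  refine IsEigen.sum _ fun p hp => IsEigen.sum _ fun b _ => hF.comp_affine ?_
  obtain ⟨hp1, hp2⟩ := Nat.mem_divisorsAntidiagonal.1 hp
  have h1 : 0 < p.1 := Nat.pos_of_ne_zero fun h => hp2 (by rw [← hp1, h, zero_mul])
  have h2 : 0 < p.2 := Nat.pos_of_ne_zero fun h => hp2 (by rw [← hp1, h, mul_zero])
  positivity

theorem isBigO_comp_affine {u : UpperHalfPlane → ℂ} {C : ℝ}
    (hu : u =O[UpperHalfPlane.atImInfty] fun z => z.im ^ C) {α : ℝ} (hα : 0 < α) (β : ℝ) :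
    (fun z : UpperHalfPlane => u (UpperHalfPlane.ofComplex (α * z + β)))
      =O[UpperHalfPlane.atImInfty] fun z => z.im ^ C := by
  have him (z : UpperHalfPlane) : 0 < ((α : ℂ) * z + β).im := by
    simpa using mul_pos hα z.im_pos
  have him' (z : UpperHalfPlane) : (UpperHalfPlane.ofComplex (α * z + β)).im = α * z.im := by
    rw [UpperHalfPlane.ofComplex_apply_of_im_pos (him z)]
    change ((α : ℂ) * z + β).im = _
    simp
  have ht : Filter.Tendsto (fun z : UpperHalfPlane => UpperHalfPlane.ofComplex (α * z + β))
      UpperHalfPlane.atImInfty UpperHalfPlane.atImInfty := by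
    refine Filter.tendsto_comap_iff.2 ?_
    have h : (UpperHalfPlane.im ∘ fun z : UpperHalfPlane =>
        UpperHalfPlane.ofComplex (α * z + β)) = fun z => α * z.im := funext him'
    rw [h]
    exact Filter.tendsto_comap.const_mul_atTop hα
  refine (hu.comp_tendsto ht).trans ?_
  have h : ((fun z : UpperHalfPlane => z.im ^ C) ∘ fun z : UpperHalfPlane =>
      UpperHalfPlane.ofComplex (α * z + β)) = fun z => α ^ C * z.im ^ C := by
    funext z
    simp only [Function.comp_apply]
    rw [him', Real.mul_rpow hα.le z.im_pos.le]
  rw [h]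
  exact Asymptotics.isBigO_const_mul_self _ _ _

theorem IsMaassCuspForm.heckeInf {m : ℕ} (hm : 1 ≤ m) {X : Sums} (hX : X ∈ RPos m)
    (hcomp : IsCompatible m X) {s : ℂ} {u : UpperHalfPlane → ℂ} (hu : IsMaassCuspForm s u) :
    IsMaassCuspForm s (slashUpper u (heckeInf m)) := by
  have hmod := (isModular_of_invariant hu.invariant).heckeInf hm hX hcomp
  have heig : IsEigen s fun w => u (UpperHalfPlane.ofComplex w) := by
    refine ⟨hu.analytic, fun z hz => ?_⟩
    have h := hu.eigen ⟨z, hz⟩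
    beta_reduce
    rwa [UpperHalfPlane.ofComplex_apply_of_im_pos hz]
  have heig' : IsEigen s fun w =>
      slashUpper u (PeriodHecke.heckeInf m) (UpperHalfPlane.ofComplex w) := by
    refine (heig.heckeInf m).congr fun z hz => ?_
    simp only [slashUpper]
    rw [UpperHalfPlane.ofComplex_apply_of_im_pos hz]
  refine ⟨heig'.1, fun g z => invariant_of_isModular hmod g z, fun z => ?_, fun C => ?_⟩
  · have h := heig'.2 z z.im_pos
    beta_reduce at h
    rwa [UpperHalfPlane.ofComplex_apply] at h
  · have h : slashUpper u (PeriodHecke.heckeInf m) = fun z : UpperHalfPlane =>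
        ∑ p ∈ m.divisorsAntidiagonal, ∑ b ∈ Finset.range p.2, u (UpperHalfPlane.ofComplex
          (((p.1 / p.2 : ℝ) : ℂ) * z + ((b / p.2 : ℝ) : ℂ))) := by
      funext z
      rw [slashUpper, slash_zero_heckeInf]
      refine Finset.sum_congr rfl fun p _ => Finset.sum_congr rfl fun b _ => ?_
      congr 2
      push_cast
      ring
    rw [h]
    refine Asymptotics.IsBigO.fun_sum fun p hp => Asymptotics.IsBigO.fun_sum fun b _ =>
      isBigO_comp_affine (hu.decay C) ?_ _
    obtain ⟨hp1, hp2⟩ := Nat.mem_divisorsAntidiagonal.1 hp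
    have h1 : 0 < p.1 := Nat.pos_of_ne_zero fun h => hp2 (by rw [← hp1, h, zero_mul])
    have h2 : 0 < p.2 := Nat.pos_of_ne_zero fun h => hp2 (by rw [← hp1, h, mul_zero])
    positivity

/-! ### Hecke operators on Fourier expansions -/

theorem hasSum_of_eq {ι : Type*} {f g : ι → ℂ} {v : ℂ} (h : ∀ n, f n = g n) (hg : HasSum g v) :
    HasSum f v := by
  rwa [funext h]

theorem sum_range_exp (d : ℕ) (hd : 0 < d) (n : ℤ) :
    ∑ b ∈ Finset.range d, Complex.exp (2 * Real.pi * Complex.I * n * b / d) =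
      if (d : ℤ) ∣ n then (d : ℂ) else 0 := by
  have hd0 : (d : ℂ) ≠ 0 := by exact_mod_cast hd.ne'
  have hpow (b : ℕ) : Complex.exp (2 * Real.pi * Complex.I * n * b / d) =
      Complex.exp (2 * Real.pi * Complex.I * n / d) ^ b := by
    rw [← Complex.exp_nat_mul]
    congr 1
    ring
  simp only [hpow]
  split_ifs with h
  · obtain ⟨k, rfl⟩ := h
    have h1 : Complex.exp (2 * Real.pi * Complex.I * ((d * k : ℤ) : ℂ) / d) = 1 := by
      rw [Complex.exp_eq_one_iff]
      refine ⟨k, ?_⟩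
      push_cast
      field_simp
    rw [h1]
    simp
  · have h1 : Complex.exp (2 * Real.pi * Complex.I * n / d) ≠ 1 := by
      rw [Ne, Complex.exp_eq_one_iff]
      rintro ⟨k, hk⟩
      apply h
      refine ⟨k, ?_⟩
      have h2 := Complex.two_pi_I_ne_zero
      have h3 : (n : ℂ) = d * k := by
        field_simp at hk
        exact hk
      exact_mod_cast h3
    rw [geom_sum_eq h1, ← hpow]
    have h2 : Complex.exp (2 * Real.pi * Complex.I * n * d / d) = 1 := by
      rw [Complex.exp_eq_one_iff]
      refine ⟨n, ?_⟩
      field_simp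
    rw [h2]
    simp

theorem hasSum_hecke_term {ι : Type*} (k : ι → ℤ) {d : ℕ} (hd : 0 < d) {μ ν : ι → ι}
    (hμ : Function.Injective μ) (hν : Function.Injective ν)
    (hr : ∀ n, (d : ℤ) ∣ k n ↔ n ∈ Set.range μ) {G : ι → ℂ} {v : ℕ → ℂ}
    (h : ∀ b ∈ Finset.range d,
      HasSum (fun n => G n * Complex.exp (2 * Real.pi * Complex.I * k n * b / d)) (v b)) :
    HasSum (Function.extend ν (fun n => G (μ n) * d) 0) (∑ b ∈ Finset.range d, v b) := by
  rw [hasSum_extend_zero hν]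
  have h1 := hasSum_sum h
  simp only [← Finset.mul_sum, sum_range_exp d hd] at h1
  rw [← hμ.hasSum_iff] at h1
  · convert h1 using 2 with n
    rw [Function.comp_apply, if_pos ((hr _).2 ⟨n, rfl⟩)]
  · intro n hn
    rw [if_neg fun h => hn ((hr n).1 h), mul_zero]

/-- The Fourier coefficients of `u|_0 T_m^∞`. -/
def heckeCoeff (m : ℕ) (α : ℤ → ℂ) (N : ℤ) : ℂ :=
  ∑ p ∈ m.divisorsAntidiagonal,
    if (p.1 : ℤ) ∣ N then (Real.sqrt m : ℂ) * α (p.2 * (N / p.1)) else 0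

theorem pos_of_mem_divisorsAntidiagonal {m : ℕ} {p : ℕ × ℕ} (hp : p ∈ m.divisorsAntidiagonal) :
    0 < p.1 ∧ 0 < p.2 ∧ p.1 * p.2 = m := by
  obtain ⟨hp1, hp2⟩ := Nat.mem_divisorsAntidiagonal.1 hp
  exact ⟨Nat.pos_of_ne_zero fun h => hp2 (by rw [← hp1, h, zero_mul]),
    Nat.pos_of_ne_zero fun h => hp2 (by rw [← hp1, h, mul_zero]), hp1⟩

/-- Multiplication by a nonzero integer on the nonzero integers. -/
def mulNonzero (a : ℕ) (ha : 0 < a) (n : {n : ℤ // n ≠ 0}) : {n : ℤ // n ≠ 0} :=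
  ⟨a * n, mul_ne_zero (by exact_mod_cast ha.ne') n.2⟩

theorem mulNonzero_injective (a : ℕ) (ha : 0 < a) : Function.Injective (mulNonzero a ha) := by
  intro n k h
  have h1 : (a : ℤ) * n = a * k := congrArg Subtype.val h
  exact Subtype.ext (mul_left_cancel₀ (by exact_mod_cast ha.ne') h1)

theorem dvd_iff_mem_range_mulNonzero (a : ℕ) (ha : 0 < a) (n : {n : ℤ // n ≠ 0}) :
    (a : ℤ) ∣ n ↔ n ∈ Set.range (mulNonzero a ha) := by
  constructor
  · rintro ⟨k, hk⟩
    have hk0 : k ≠ 0 := by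
      rintro rfl
      exact n.2 (by rw [hk, mul_zero])
    exact ⟨⟨k, hk0⟩, Subtype.ext hk.symm⟩
  · rintro ⟨k, rfl⟩
    exact ⟨k, rfl⟩

theorem sqrt_div_mul {a d : ℕ} (ha : 0 < a) (hd : 0 < d) {y : ℝ} (hy : 0 < y) :
    Real.sqrt (a / d * y) * d = Real.sqrt y * Real.sqrt ((a * d : ℕ) : ℝ) := by
  have hd' : (0 : ℝ) < d := by exact_mod_cast hd
  have ha' : (0 : ℝ) < a := by exact_mod_cast ha
  have h : (d : ℝ) = Real.sqrt (d ^ 2) := (Real.sqrt_sq hd'.le).symm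
  rw [← Real.sqrt_mul hy.le]
  nth_rewrite 2 [h]
  rw [← Real.sqrt_mul (by positivity)]
  congr 1
  push_cast
  field_simp

theorem HasFourierExpansion.heckeInf {s : ℂ} {u : UpperHalfPlane → ℂ} {α : ℤ → ℂ}
    (h : HasFourierExpansion s u α) (m : ℕ) :
    HasFourierExpansion s (slashUpper u (heckeInf m)) (heckeCoeff m α) := by
  intro z
  rw [slashUpper, slash_zero_heckeInf]
  have hterm : ∀ p (hp : p ∈ m.divisorsAntidiagonal), HasSum
      (Function.extend (mulNonzero p.1 (pos_of_mem_divisorsAntidiagonal hp).1)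
        (fun n => (Real.sqrt (p.1 / p.2 * z.im) : ℂ) *
          (α (p.2 * n) * besselK (s - 1 / 2)
            (2 * Real.pi * |(((p.2 * n : ℤ)) : ℝ)| * (p.1 / p.2 * z.im)) *
          Complex.exp (2 * Real.pi * Complex.I * ((p.2 * n : ℤ) : ℂ) * (p.1 / p.2 * z.re : ℝ))) *
            p.2) 0)
      (∑ b ∈ Finset.range p.2, u (UpperHalfPlane.ofComplex ((p.1 * z + b) / p.2))) := by
    intro p hp
    obtain ⟨h1, h2, -⟩ := pos_of_mem_divisorsAntidiagonal hp
    have h1' : (0 : ℝ) < p.1 := by exact_mod_cast h1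
    have h2' : (0 : ℝ) < p.2 := by exact_mod_cast h2
    refine hasSum_hecke_term (fun n : {n : ℤ // n ≠ 0} => (n : ℤ)) h2
      (mulNonzero_injective p.2 h2) (mulNonzero_injective p.1 h1)
      (dvd_iff_mem_range_mulNonzero p.2 h2) (G := fun n => (Real.sqrt (p.1 / p.2 * z.im) : ℂ) *
          (α n * besselK (s - 1 / 2)
            (2 * Real.pi * |((n : ℤ) : ℝ)| * (p.1 / p.2 * z.im)) *
          Complex.exp (2 * Real.pi * Complex.I * ((n : ℤ) : ℂ) * (p.1 / p.2 * z.re : ℝ))))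
      fun b _ => ?_
    have hw : ((p.1 : ℂ) * z + b) / p.2 = ((p.1 / p.2 : ℝ) : ℂ) * z + ((b / p.2 : ℝ) : ℂ) := by
      push_cast
      ring
    have him : (((p.1 : ℂ) * z + b) / p.2).im = p.1 / p.2 * z.im := by
      rw [hw]
      simp [-Complex.ofReal_div]
    have hre : (((p.1 : ℂ) * z + b) / p.2).re = p.1 / p.2 * z.re + b / p.2 := by
      rw [hw]
      simp [-Complex.ofReal_div]
    have him0 : 0 < (((p.1 : ℂ) * z + b) / p.2).im := by
      rw [him]
      have := z.im_pos
      positivity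
    have e := h ⟨_, him0⟩
    rw [UpperHalfPlane.ofComplex_apply_of_im_pos him0]
    refine hasSum_of_eq (fun n => ?_) e
    have hexp : Complex.exp (2 * Real.pi * Complex.I * ((n : ℤ) : ℂ) *
        (((((p.1 : ℂ) * z + b) / p.2).re : ℝ) : ℂ)) =
        Complex.exp (2 * Real.pi * Complex.I * ((n : ℤ) : ℂ) * (p.1 / p.2 * z.re : ℝ)) *
        Complex.exp (2 * Real.pi * Complex.I * ((n : ℤ) : ℂ) * b / p.2) := by
      rw [← Complex.exp_add, hre]
      congr 1
      push_cast
      ring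
    change _ = ((Real.sqrt (((p.1 : ℂ) * z + b) / p.2).im : ℝ) : ℂ) *
      (α n * besselK (s - 1 / 2) (2 * Real.pi * |((n : ℤ) : ℝ)| * (((p.1 : ℂ) * z + b) / p.2).im) *
        Complex.exp (2 * Real.pi * Complex.I * ((n : ℤ) : ℂ) *
        (((((p.1 : ℂ) * z + b) / p.2).re : ℝ) : ℂ)))
    rw [hexp, him]
    ring
  have hs := hasSum_sum fun (p : {p // p ∈ m.divisorsAntidiagonal})
    (_ : p ∈ m.divisorsAntidiagonal.attach) => hterm p.1 p.2
  rw [Finset.sum_attach m.divisorsAntidiagonal fun p =>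
    ∑ b ∈ Finset.range p.2, u (UpperHalfPlane.ofComplex ((p.1 * z + b) / p.2))] at hs
  refine hasSum_of_eq (fun N => ?_) hs
  rw [heckeCoeff, ← Finset.sum_attach, Finset.sum_mul, Finset.sum_mul, Finset.mul_sum]
  refine Finset.sum_congr rfl fun p _ => ?_
  obtain ⟨h1, h2, h3⟩ := pos_of_mem_divisorsAntidiagonal p.2
  by_cases hN : N ∈ Set.range (mulNonzero p.1.1 h1)
  · rw [if_pos ((dvd_iff_mem_range_mulNonzero _ h1 _).2 hN)]
    obtain ⟨n, rfl⟩ := hN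
    rw [(mulNonzero_injective _ h1).extend_apply]
    have h1' : (0 : ℝ) < p.1.1 := by exact_mod_cast h1
    have h2' : (0 : ℝ) < p.1.2 := by exact_mod_cast h2
    have e1 : ((mulNonzero p.1.1 h1 n : {n : ℤ // n ≠ 0}) : ℤ) / (p.1.1 : ℤ) = n :=
      Int.mul_ediv_cancel_left _ (by exact_mod_cast h1.ne')
    have e2 : 2 * Real.pi * |((p.1.2 * n : ℤ) : ℝ)| * (p.1.1 / p.1.2 * z.im) =
        2 * Real.pi * |((mulNonzero p.1.1 h1 n : ℤ) : ℝ)| * z.im := by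
      simp only [mulNonzero]
      push_cast
      rw [abs_mul, abs_mul, abs_of_pos h1', abs_of_pos h2']
      field_simp
    have e3 : 2 * Real.pi * Complex.I * ((p.1.2 * n : ℤ) : ℂ) * (p.1.1 / p.1.2 * z.re : ℝ) =
        2 * Real.pi * Complex.I * ((mulNonzero p.1.1 h1 n : ℤ) : ℂ) * z.re := by
      have : (p.1.2 : ℂ) ≠ 0 := by exact_mod_cast h2.ne'
      simp only [mulNonzero]
      push_cast
      field_simp
    have e4 : ((Real.sqrt (p.1.1 / p.1.2 * z.im) : ℝ) : ℂ) * p.1.2 =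
        (Real.sqrt z.im : ℝ) * (Real.sqrt m : ℝ) := by
      have e5 := sqrt_div_mul h1 h2 z.im_pos
      rw [h3] at e5
      exact_mod_cast congrArg (fun x : ℝ => (x : ℂ)) e5
    rw [e1, e2, e3]
    linear_combination (-(α (p.1.2 * n) * besselK (s - 1 / 2)
      (2 * Real.pi * |((mulNonzero p.1.1 h1 n : ℤ) : ℝ)| * z.im) *
      Complex.exp (2 * Real.pi * Complex.I * ((mulNonzero p.1.1 h1 n : ℤ) : ℂ) * z.re))) * e4
  · rw [if_neg fun h => hN ((dvd_iff_mem_range_mulNonzero _ h1 _).1 h),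
      Function.extend_apply' _ _ _ hN]
    simp

/-- Multiplication by a positive integer on the positive integers. -/
def mulPNat (a : ℕ) (ha : 0 < a) (n : ℕ+) : ℕ+ := ⟨a * n, Nat.mul_pos ha n.2⟩

theorem mulPNat_injective (a : ℕ) (ha : 0 < a) : Function.Injective (mulPNat a ha) := by
  intro n k h
  have h1 : a * (n : ℕ) = a * k := congrArg PNat.val h
  exact PNat.coe_injective (Nat.eq_of_mul_eq_mul_left ha h1)

theorem dvd_iff_mem_range_mulPNat (a : ℕ) (ha : 0 < a) {ε : ℤ} (hε : IsUnit ε) (n : ℕ+) :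
    (a : ℤ) ∣ ε * ((n : ℕ) : ℤ) ↔ n ∈ Set.range (mulPNat a ha) := by
  rw [hε.dvd_mul_left, Int.natCast_dvd_natCast]
  constructor
  · rintro ⟨k, hk⟩
    have hk0 : 0 < k := Nat.pos_of_ne_zero fun h => n.ne_zero (by rw [hk, h, mul_zero])
    exact ⟨⟨k, hk0⟩, PNat.coe_injective hk.symm⟩
  · rintro ⟨k, rfl⟩
    exact ⟨k, rfl⟩

theorem cpow_coeff_identity (s : ℂ) {a d n : ℕ} (ha : 0 < a) (hd : 0 < d) :
    ((a * d : ℕ) : ℂ) ^ s * (d : ℂ) ^ (-(2 * s)) * ((d * n : ℕ) : ℂ) ^ (s - 1 / 2) * d =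
      ((a * n : ℕ) : ℂ) ^ (s - 1 / 2) * (Real.sqrt ((a * d : ℕ) : ℝ) : ℂ) := by
  have ha0 : (a : ℂ) ≠ 0 := by exact_mod_cast ha.ne'
  have hd0 : (d : ℂ) ≠ 0 := by exact_mod_cast hd.ne'
  have hsqrt : (Real.sqrt ((a * d : ℕ) : ℝ) : ℂ) = ((a * d : ℕ) : ℂ) ^ (1 / 2 : ℂ) := by
    rw [Real.sqrt_eq_rpow, Complex.ofReal_cpow (by positivity)]
    push_cast
    rfl
  have e1 : (d : ℂ) ^ (1 / 2 : ℂ) =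
      (d : ℂ) ^ s * (d : ℂ) ^ (-(2 * s)) * (d : ℂ) ^ (s - 1 / 2) * d := by
    nth_rewrite 5 [← Complex.cpow_one (d : ℂ)]
    rw [← Complex.cpow_add _ _ hd0, ← Complex.cpow_add _ _ hd0, ← Complex.cpow_add _ _ hd0]
    congr 1
    ring
  have e2 : (a : ℂ) ^ s = (a : ℂ) ^ (s - 1 / 2) * (a : ℂ) ^ (1 / 2 : ℂ) := by
    rw [← Complex.cpow_add _ _ ha0]
    congr 1
    ring
  rw [hsqrt]
  push_cast
  rw [Complex.natCast_mul_natCast_cpow, Complex.natCast_mul_natCast_cpow,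
    Complex.natCast_mul_natCast_cpow, Complex.natCast_mul_natCast_cpow, e1, e2]
  ring

/-- The function `f|_{2s} T_m^∞`. -/
def heckePeriodic (s : ℂ) (m : ℕ) (f : ℂ → ℂ) (z : ℂ) : ℂ :=
  ∑ p ∈ m.divisorsAntidiagonal, ∑ b ∈ Finset.range p.2,
    (m : ℂ) ^ s * (p.2 : ℂ) ^ (-(2 * s)) * f ((p.1 * z + b) / p.2)

theorem hasSum_heckePeriodic {s : ℂ} {f : ℂ → ℂ} {α : ℤ → ℂ} {ε : ℤ} (hε : IsUnit ε) (m : ℕ)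
    {P : ℂ → Prop}
    (hP : ∀ z, P z → ∀ p ∈ m.divisorsAntidiagonal, ∀ b : ℕ, P (((p.1 : ℂ) * z + b) / p.2))
    (h : ∀ z, P z → HasSum (fun n : ℕ+ => ((n : ℕ) : ℂ) ^ (s - 1 / 2) * α (ε * ((n : ℕ) : ℤ)) *
      Complex.exp (2 * Real.pi * Complex.I * ((ε * ((n : ℕ) : ℤ) : ℤ) : ℂ) * z)) (f z))
    {z : ℂ} (hz : P z) :
    HasSum (fun n : ℕ+ => ((n : ℕ) : ℂ) ^ (s - 1 / 2) * heckeCoeff m α (ε * ((n : ℕ) : ℤ)) *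
      Complex.exp (2 * Real.pi * Complex.I * ((ε * ((n : ℕ) : ℤ) : ℤ) : ℂ) * z))
      (heckePeriodic s m f z) := by
  have hterm : ∀ p (hp : p ∈ m.divisorsAntidiagonal), HasSum
      (Function.extend (mulPNat p.1 (pos_of_mem_divisorsAntidiagonal hp).1)
        (fun n : ℕ+ => (m : ℂ) ^ s * (p.2 : ℂ) ^ (-(2 * s)) * (((p.2 * n : ℕ) : ℂ) ^ (s - 1 / 2) *
          α (ε * ((p.2 * n : ℕ) : ℤ)) *
          Complex.exp (2 * Real.pi * Complex.I * ((ε * ((p.2 * n : ℕ) : ℤ) : ℤ) : ℂ) *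
            (p.1 * z / p.2))) * p.2) 0)
      (∑ b ∈ Finset.range p.2,
        (m : ℂ) ^ s * (p.2 : ℂ) ^ (-(2 * s)) * f ((p.1 * z + b) / p.2)) := by
    intro p hp
    obtain ⟨h1, h2, -⟩ := pos_of_mem_divisorsAntidiagonal hp
    refine hasSum_hecke_term (fun n : ℕ+ => ε * ((n : ℕ) : ℤ)) h2
      (mulPNat_injective p.2 h2) (mulPNat_injective p.1 h1)
      (dvd_iff_mem_range_mulPNat p.2 h2 hε)
      (G := fun n => (m : ℂ) ^ s * (p.2 : ℂ) ^ (-(2 * s)) * (((n : ℕ) : ℂ) ^ (s - 1 / 2) *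
          α (ε * ((n : ℕ) : ℤ)) *
          Complex.exp (2 * Real.pi * Complex.I * ((ε * ((n : ℕ) : ℤ) : ℤ) : ℂ) *
            (p.1 * z / p.2))))
      fun b _ => ?_
    refine hasSum_of_eq (fun n => ?_)
      ((h _ (hP z hz p hp b)).mul_left ((m : ℂ) ^ s * (p.2 : ℂ) ^ (-(2 * s))))
    rw [mul_assoc, mul_assoc (_ ^ (s - 1 / 2) * _), ← Complex.exp_add]
    congr 4
    ring
  have hs := hasSum_sum fun (p : {p // p ∈ m.divisorsAntidiagonal})
    (_ : p ∈ m.divisorsAntidiagonal.attach) => hterm p.1 p.2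
  rw [Finset.sum_attach m.divisorsAntidiagonal fun p => ∑ b ∈ Finset.range p.2,
        (m : ℂ) ^ s * (p.2 : ℂ) ^ (-(2 * s)) * f ((p.1 * z + b) / p.2)] at hs
  refine hasSum_of_eq (fun N => ?_) hs
  rw [heckeCoeff, ← Finset.sum_attach, Finset.mul_sum, Finset.sum_mul]
  refine Finset.sum_congr rfl fun p _ => ?_
  obtain ⟨h1, h2, h3⟩ := pos_of_mem_divisorsAntidiagonal p.2
  by_cases hN : N ∈ Set.range (mulPNat p.1.1 h1)
  · rw [if_pos ((dvd_iff_mem_range_mulPNat _ h1 hε N).2 hN)]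
    obtain ⟨n, rfl⟩ := hN
    rw [(mulPNat_injective _ h1).extend_apply]
    have hd0 : (p.1.2 : ℂ) ≠ 0 := by exact_mod_cast h2.ne'
    have e0 : ((mulPNat p.1.1 h1 n : ℕ+) : ℕ) = p.1.1 * n := rfl
    have e1 : (p.1.2 : ℤ) * (ε * (((mulPNat p.1.1 h1 n : ℕ+) : ℕ) : ℤ) / (p.1.1 : ℤ)) =
        ε * ((p.1.2 * n : ℕ) : ℤ) := by
      rw [e0]
      push_cast
      rw [mul_left_comm ε, Int.mul_ediv_cancel_left _ (by exact_mod_cast h1.ne')]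
      ring
    have e2 : 2 * Real.pi * Complex.I * ((ε * ((p.1.2 * n : ℕ) : ℤ) : ℤ) : ℂ) *
            (p.1.1 * z / p.1.2) = 2 * Real.pi * Complex.I *
            ((ε * (((mulPNat p.1.1 h1 n : ℕ+) : ℕ) : ℤ) : ℤ) : ℂ) * z := by
      rw [e0]
      push_cast
      field_simp
    have e3 := cpow_coeff_identity s (n := n) h1 h2
    rw [h3] at e3
    rw [e1, e2, e0]
    linear_combination (-(α (ε * ((p.1.2 * n : ℕ) : ℤ)) * Complex.exp (2 * Real.pi * Complex.I *
            ((ε * ((p.1.1 * n : ℕ) : ℤ) : ℤ) : ℂ) * z))) * e3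
  · rw [if_neg fun h => hN ((dvd_iff_mem_range_mulPNat _ h1 hε N).1 h),
      Function.extend_apply' _ _ _ hN]
    simp

theorem heckeCoeff_neg (m : ℕ) (α : ℤ → ℂ) (N : ℤ) :
    heckeCoeff m (fun n => -α n) N = -heckeCoeff m α N := by
  rw [heckeCoeff, heckeCoeff, ← Finset.sum_neg_distrib]
  refine Finset.sum_congr rfl fun p _ => ?_
  split_ifs <;> simp

theorem HasPeriodicExpansion.heckePeriodic {s : ℂ} {f : ℂ → ℂ} {α : ℤ → ℂ}
    (h : HasPeriodicExpansion s f α) (m : ℕ) :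
    HasPeriodicExpansion s (heckePeriodic s m f) (heckeCoeff m α) := by
  have him (z : ℂ) (p : ℕ × ℕ) (b : ℕ) :
      (((p.1 : ℂ) * z + b) / p.2).im = p.1 * z.im / p.2 := by
    simp
  constructor
  · intro z hz
    have h1 := hasSum_heckePeriodic (s := s) (f := f) (α := α) isUnit_one m
      (P := fun z => 0 < z.im)
      (fun z hz p hp b => by
        obtain ⟨h1, h2, -⟩ := pos_of_mem_divisorsAntidiagonal hp
        rw [him]
        positivity)
      (fun z hz => by simpa using h.1 z hz) hz
    simpa using h1
  · intro z hz
    have h1 := hasSum_heckePeriodic (s := s) (f := f) (α := fun n => -α n)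
      (isUnit_one.neg : IsUnit (-1 : ℤ)) m
      (P := fun z => z.im < 0)
      (fun z hz p hp b => by
        obtain ⟨h1, h2, -⟩ := pos_of_mem_divisorsAntidiagonal hp
        rw [him]
        have h1' : (0 : ℝ) < p.1 := by exact_mod_cast h1
        have h2' : (0 : ℝ) < p.2 := by exact_mod_cast h2
        exact div_neg_of_neg_of_pos (mul_neg_of_pos_of_neg h1' hz) h2')
      (fun z hz => by simpa using h.2 z hz) hz
    simpa [heckeCoeff_neg] using h1

/-! ### The period function of the image of a cusp form -/

/-- A bottom row normalised to make `cz + d` lie in the half plane of `z` or on the positive real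
axis. -/
def IsNormalized (A : Matrix (Fin 2) (Fin 2) ℤ) : Prop := 0 < A 1 0 ∨ (A 1 0 = 0 ∧ 0 < A 1 1)

/-- The representative up to sign with normalised bottom row. -/
def normalize (A : Matrix (Fin 2) (Fin 2) ℤ) : Matrix (Fin 2) (Fin 2) ℤ :=
  open Classical in if IsNormalized A then A else -A

theorem IsNormalized.not_neg {A : Matrix (Fin 2) (Fin 2) ℤ} (h : IsNormalized A) :
    ¬ IsNormalized (-A) := by
  intro h'
  simp only [IsNormalized, Matrix.neg_apply] at h h'
  lia

theorem normalize_rep_cls {A : Matrix (Fin 2) (Fin 2) ℤ} (h : IsNormalized A) :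
    normalize (rep (cls A)) = A := by
  rcases (cls_eq_iff _ _).1 (cls_rep (cls A)) with e | e
  · rw [e, normalize, if_pos h]
  · rw [e, normalize, if_neg h.not_neg, neg_neg]

theorem cls_normalize_rep (g : MatPM) : cls (normalize (rep g)) = g := by
  conv_rhs => rw [← cls_rep g]
  rw [cls_eq_iff, normalize]
  split_ifs
  · exact Or.inl rfl
  · exact Or.inr rfl

theorem isNormalized_normalize {A : Matrix (Fin 2) (Fin 2) ℤ} (h : A.det ≠ 0) :
    IsNormalized (normalize A) := by
  rw [normalize]
  split_ifs with h1
  · exact h1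
  · have h2 : ¬ (A 1 0 = 0 ∧ A 1 1 = 0) := by
      rintro ⟨h2, h3⟩
      apply h
      rw [Matrix.det_fin_two, h2, h3]
      ring
    simp only [IsNormalized, Matrix.neg_apply] at h1 ⊢
    lia

theorem det_normalize (A : Matrix (Fin 2) (Fin 2) ℤ) : (normalize A).det = A.det := by
  rw [normalize]
  split_ifs
  · rfl
  · rw [Matrix.det_neg]
    simp

theorem IsPositive.isNormalized {A : Matrix (Fin 2) (Fin 2) ℤ} (hA : IsPositive A) :
    IsNormalized A := by
  have h1 := hA.1 1 0
  have h2 := hA.diag_pos.2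
  rw [IsNormalized]
  lia

theorem HasPeriodicExpansion.periodic {s : ℂ} {f : ℂ → ℂ} {α : ℤ → ℂ}
    (h : HasPeriodicExpansion s f α) {z : ℂ} (hz : z.im ≠ 0) : f (z + 1) = f z := by
  have hexp (k : ℤ) : Complex.exp (2 * Real.pi * Complex.I * k * (z + 1)) =
      Complex.exp (2 * Real.pi * Complex.I * k * z) := by
    rw [Complex.exp_eq_exp_iff_exists_int]
    exact ⟨k, by ring⟩
  rcases lt_or_gt_of_ne hz with hz | hz
  · have h1 := h.2 (z + 1) (by simpa using hz)
    refine h1.unique (hasSum_of_eq (fun n => ?_) (h.2 z hz))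
    have := hexp (-((n : ℕ) : ℤ))
    push_cast at this
    rw [this]
  · have h1 := h.1 (z + 1) (by simpa using hz)
    refine h1.unique (hasSum_of_eq (fun n => ?_) (h.1 z hz))
    have := hexp ((n : ℕ) : ℤ)
    push_cast at this
    rw [this]

theorem slashMat_T_mul {f : ℂ → ℂ} (hf : ∀ z : ℂ, z.im ≠ 0 → f (z + 1) = f z) (w : ℂ)
    {A : Matrix (Fin 2) (Fin 2) ℤ} (hA : A.det ≠ 0) {z : ℂ} (hz : z.im ≠ 0) :
    slashMat w f (!![1, 1; 0, 1] * A) z = slashMat w f A z := by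
  have hd := den_ne_zero hA hz
  have hden : den (!![1, 1; 0, 1] * A) z = den A z := by
    simp [den, Matrix.mul_apply, Fin.sum_univ_two]
  have hmoeb : moeb (!![1, 1; 0, 1] * A) z = moeb A z + 1 := by
    rw [moeb_mul hd]
    simp [moeb.eq_1 !![1, 1; 0, 1], num, den]
  have hdet : (!![1, 1; 0, 1] * A).det = A.det := by
    rw [Matrix.det_mul, Matrix.det_fin_two_of]
    ring
  have him : (moeb A z).im ≠ 0 := by
    rw [moeb_im]
    have h1 : Complex.normSq (den A z) ≠ 0 := (Complex.normSq_pos.2 hd).ne'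
    have h2 : (A.det : ℝ) ≠ 0 := by exact_mod_cast hA
    exact div_ne_zero (mul_ne_zero h2 hz) h1
  rw [slashMat_eq, slashMat_eq, hden, hmoeb, hdet, hf _ him]

/-- The extension to formal sums of the slash action on functions on `ℂ ∖ ℝ`, by means of the
representatives with normalised bottom row. -/
def slashNormalized (w : ℂ) (f : ℂ → ℂ) (z : ℂ) : Sums →+ ℂ :=
  lin fun g => slashMat w f (normalize (rep g)) z

theorem slashNormalized_T_sub_one_mul {m : ℕ} (hm : 1 ≤ m) {f : ℂ → ℂ}
    (hf : ∀ z : ℂ, z.im ≠ 0 → f (z + 1) = f z) (w : ℂ) {z : ℂ} (hz : z.im ≠ 0) {Y : Sums}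
    (hY : Y ∈ R m) : slashNormalized w f z ((T - 1) * Y) = 0 := by
  rw [slashNormalized, sub_mul, one_mul, map_sub, T, mat, lin_of_mul, sub_eq_zero]
  refine lin_congr fun g hg => ?_
  have hdet : (rep g).det ≠ 0 := by
    rw [det_rep_of_mem (hY g hg)]
    exact_mod_cast (by lia : m ≠ 0)
  have hdet' : (normalize (rep g)).det ≠ 0 := by rwa [det_normalize]
  have hn := isNormalized_normalize hdet
  have e : cls !![1, 1; 0, 1] * g = cls (!![1, 1; 0, 1] * normalize (rep g)) := by
    conv_lhs => rw [← cls_normalize_rep g]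
    rfl
  rw [e, normalize_rep_cls, slashMat_T_mul hf w hdet' hz]
  rw [IsNormalized] at hn ⊢
  simpa [Matrix.mul_apply, Fin.sum_univ_two] using hn

theorem slashNormalized_sub {m : ℕ} (hm : 1 ≤ m) {X : Sums} (hX : X ∈ RPos m) {c s : ℂ}
    {f : ℂ → ℂ} {ψ : Complex.slitPlane → ℂ}
    (h : ∀ z : Complex.slitPlane, (z : ℂ).im ≠ 0 →
      c * ψ z = f z - (z : ℂ) ^ (-2 * s) * f (-1 / (z : ℂ)))
    {z : ℂ} (hz : z.im ≠ 0) :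
    slashNormalized (2 * s) f z X - slashNormalized (2 * s) f z (S * X) =
      c * slash (2 * s) (ext ψ) X z := by
  have hslit : z ∈ Complex.slitPlane := Complex.mem_slitPlane_iff.2 (Or.inr hz)
  rw [slash_eq_lin, ← lin_const_mul, slashNormalized, S, mat, lin_of_mul, ← lin_sub_fun]
  refine lin_congr fun g hg => ?_
  have hA := isPositive_rep hm (hX g hg)
  set A := rep g with hAdef
  have hgA : g = cls A := (cls_rep g).symm
  have hSn : IsNormalized (!![0, -1; 1, 0] * A) := by
    have h1 := hA.diag_pos.1
    left
    simpa [Matrix.mul_apply, Fin.sum_univ_two] using h1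
  have hn1 : normalize A = A := by
    have h1 := normalize_rep_cls hA.isNormalized
    rwa [← hgA] at h1
  have hn2 : normalize (rep (cls !![0, -1; 1, 0] * g)) = !![0, -1; 1, 0] * A := by
    rw [hgA]
    exact normalize_rep_cls hSn
  have hd := sameSide_den hA hslit
  have hd0 := Complex.slitPlane_ne_zero hd.1
  have hmo := sameSide_moeb hA hslit
  have hnum : num A z = den A z * moeb A z := by
    rw [moeb]
    field_simp
  have hSden : den (!![0, -1; 1, 0] * A) z = num A z := by
    simp [den, num, Matrix.mul_apply, Fin.sum_univ_two]
  have hSmoeb : moeb (!![0, -1; 1, 0] * A) z = -1 / moeb A z := by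
    rw [moeb_mul hd0]
    simp [moeb.eq_1 !![0, -1; 1, 0], num.eq_1 !![0, -1; 1, 0], den.eq_1 !![0, -1; 1, 0]]
  have hSdet : (!![0, -1; 1, 0] * A).det = A.det := by
    rw [Matrix.det_mul, Matrix.det_fin_two_of]
    ring
  have him : (moeb A z).im ≠ 0 := by
    rw [moeb_im]
    have h1 : Complex.normSq (den A z) ≠ 0 := (Complex.normSq_pos.2 hd0).ne'
    have h2 : (A.det : ℝ) ≠ 0 := by exact_mod_cast hA.2.ne'
    exact div_ne_zero (mul_ne_zero h2 hz) h1
  have hψ := h ⟨moeb A z, hmo.1⟩ him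
  rw [← ext_coe ψ] at hψ
  simp only at hψ
  have hcp : num A z ^ (-(2 * s)) = den A z ^ (-(2 * s)) * moeb A z ^ (-(2 * s)) := by
    rw [hnum]
    exact mul_cpow_of_sameSide hd hmo (hnum ▸ sameSide_num hA hslit) _
  rw [hn1, hn2, slashMat_eq, slashMat_eq, slashMat_eq, hSden, hSmoeb, hSdet, hcp]
  rw [neg_mul] at hψ
  linear_combination (-(((|A.det| : ℤ) : ℂ) ^ (2 * s / 2) * den A z ^ (-(2 * s)))) * hψ

theorem slashNormalized_heckeInf (s : ℂ) (m : ℕ) (f : ℂ → ℂ) (z : ℂ) :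
    slashNormalized (2 * s) f z (heckeInf m) = heckePeriodic s m f z := by
  rw [slashNormalized, heckeInf, map_sum, heckePeriodic]
  refine Finset.sum_congr rfl fun p hp => ?_
  rw [map_sum]
  refine Finset.sum_congr rfl fun b _ => ?_
  obtain ⟨h1, h2, h3⟩ := pos_of_mem_divisorsAntidiagonal hp
  have hn : IsNormalized !![(p.1 : ℤ), (b : ℤ); 0, (p.2 : ℤ)] := by
    right
    simpa using h2
  have hdet : (!![(p.1 : ℤ), (b : ℤ); 0, (p.2 : ℤ)]).det = m := by
    rw [Matrix.det_fin_two_of, ← h3]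
    push_cast
    ring
  rw [lin_mat, normalize_rep_cls hn, slashMat_eq, hdet]
  simp [den, num, moeb]

theorem slashNormalized_heckeInf_mul_S (s : ℂ) (m : ℕ) (f : ℂ → ℂ) {z : ℂ} (hz : z.im ≠ 0) :
    slashNormalized (2 * s) f z (heckeInf m * S) =
      z ^ (-2 * s) * heckePeriodic s m f (-1 / z) := by
  have hslit : z ∈ Complex.slitPlane := Complex.mem_slitPlane_iff.2 (Or.inr hz)
  have hz0 := Complex.slitPlane_ne_zero hslit
  rw [slashNormalized, heckeInf, Finset.sum_mul, map_sum, heckePeriodic, Finset.mul_sum]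
  refine Finset.sum_congr rfl fun p hp => ?_
  rw [Finset.sum_mul, map_sum, Finset.mul_sum]
  refine Finset.sum_congr rfl fun b _ => ?_
  obtain ⟨h1, h2, h3⟩ := pos_of_mem_divisorsAntidiagonal hp
  have h2' : (0 : ℝ) < p.2 := by exact_mod_cast h2
  have h2'' : (p.2 : ℂ) ≠ 0 := by exact_mod_cast h2.ne'
  have hn : IsNormalized !![(b : ℤ), -(p.1 : ℤ); (p.2 : ℤ), 0] := by
    left
    simpa using h2
  have hdet : (!![(b : ℤ), -(p.1 : ℤ); (p.2 : ℤ), 0]).det = m := by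
    rw [Matrix.det_fin_two_of, ← h3]
    push_cast
    ring
  have hmat : mat (p.1 : ℤ) (b : ℤ) 0 (p.2 : ℤ) * S = mat (b : ℤ) (-(p.1 : ℤ)) (p.2 : ℤ) 0 := by
    rw [S, mat_mul_mat]
    ring_nf
  have hcp : ((p.2 : ℂ) * z) ^ (-(2 * s)) = (p.2 : ℂ) ^ (-(2 * s)) * z ^ (-(2 * s)) := by
    have e1 : SameSide z (p.2 : ℂ) := by
      simpa using sameSide_linear hslit (a := 0) (b := p.2) le_rfl h2'.le (by simpa using h2')
    have e2 : SameSide z ((p.2 : ℂ) * z) := by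
      simpa using sameSide_linear hslit (a := p.2) (b := 0) h2'.le le_rfl (by simpa using h2')
    exact mul_cpow_of_sameSide e1 ⟨hslit, id, id⟩ e2 _
  have harg : ((b : ℂ) * z + -(p.1 : ℂ)) / ((p.2 : ℂ) * z) =
      ((p.1 : ℂ) * (-1 / z) + b) / p.2 := by
    field_simp
    ring
  rw [hmat, lin_mat, normalize_rep_cls hn, slashMat_eq, hdet]
  simp only [den, num, moeb, Matrix.of_apply, Matrix.cons_val', Matrix.cons_val_zero,
    Matrix.cons_val_one, Matrix.cons_val_fin_one]
  push_cast
  rw [add_zero, hcp, harg, neg_mul, mul_div_cancel_left₀ s two_ne_zero]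
  simp
  ring

theorem IsPeriodFunctionOf.heckeInf {m : ℕ} (hm : 1 ≤ m) {X : Sums} (hX : X ∈ RPos m)
    (hcomp : IsCompatible m X) {c s : ℂ} (hs : 0 < s.re) {u : UpperHalfPlane → ℂ}
    {ψ : Complex.slitPlane → ℂ} (h : IsPeriodFunctionOf c s u ψ) :
    IsPeriodFunctionOf c s (slashUpper u (heckeInf m)) (slashCut (2 * s) ψ X) := by
  obtain ⟨hu, hψ, α, f, hα, hf, hfψ⟩ := h
  refine ⟨hu.heckeInf hm hX hcomp, isPeriodFunction_slashCut hm hX hcomp hs hψ,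
    heckeCoeff m α, heckePeriodic s m f, hα.heckeInf m, hf.heckePeriodic m, fun z hz => ?_⟩
  obtain ⟨-, Y, hY, h2⟩ := hcomp
  have h3 := slashNormalized_T_sub_one_mul hm (fun w hw => hf.periodic hw) (2 * s) hz hY
  rw [← h2, mul_sub, sub_mul, mul_one, one_mul, map_sub, map_sub, map_sub,
    slashNormalized_heckeInf, slashNormalized_heckeInf_mul_S s m f hz] at h3
  have h4 := slashNormalized_sub hm hX hfψ hz
  change c * slash (2 * s) (ext ψ) X z = _
  linear_combination h3 - h4

end PeriodHecke

end

theorem corollary2p4 (m : ℕ) (hm : 1 ≤ m) (X : PeriodHecke.Sums)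
    (hX : X ∈ PeriodHecke.RPos m) (hcomp : PeriodHecke.IsCompatible m X) :
    -- `X` gives a linear operator on `FE_s`, and every other admissible `X'` gives the same one
    (∀ s : ℂ, ∃ H : PeriodHecke.FE s →ₗ[ℂ] PeriodHecke.FE s,
      (∀ ψ : PeriodHecke.FE s,
        (H ψ : Complex.slitPlane → ℂ) = PeriodHecke.slashCut (2 * s) ψ X) ∧
      ∀ X' ∈ PeriodHecke.RPos m, PeriodHecke.IsCompatible m X' →
        ∀ ψ : PeriodHecke.FE s,
          (H ψ : Complex.slitPlane → ℂ) = PeriodHecke.slashCut (2 * s) ψ X') ∧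
    -- the period function of `u|_0 T_m^∞` is `ψ|_{2s} X`
    (∀ s c : ℂ, 0 < s.re → c ≠ 0 →
      ∀ (u : UpperHalfPlane → ℂ) (ψ : Complex.slitPlane → ℂ),
        PeriodHecke.IsPeriodFunctionOf c s u ψ →
        PeriodHecke.IsPeriodFunctionOf c s
          (PeriodHecke.slashUpper u (PeriodHecke.heckeInf m))
          (PeriodHecke.slashCut (2 * s) ψ X)) := by
  refine ⟨fun s => ⟨PeriodHecke.heckeFE hm hX hcomp s, fun _ => rfl,
    fun X' hX' hcomp' ψ => PeriodHecke.slashCut_eq hm hX hcomp hX' hcomp' ψ.2⟩,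
    fun s c hs _ u ψ h => h.heckeInf hm hX hcomp hs⟩
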